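/- Let $\mathcal{C}$ be the space of all positive semidefinite $p\times p$ correlation matrices, let $\nu$ be a measure on $\mathcal{C}$, and let $\Pi$ be a prior probability distribution on $\mathcal{C}$ with density $\pi$ with respect to $\nu$, where $\pi(\boldsymbol C)>0$ for $\nu$-almost every $\boldsymbol C$. Let $F_1,\dots,F_p$ be fixed true marginal cdfs on $\mathbb{R}$ (discrete, continuous or mixed), each nondegenerate, i.e. not the cdf of a constant. Under $\boldsymbol C_0\in\mathcal C$ the observations $\boldsymbol y_1,\boldsymbol y_2,\dots$ are i.i.d. from the Gaussian copula model: $y_{ij}=F_j^{-1}(\Phi(z_{ij}))$ with $\boldsymbol z_i=(z_{i1},\dots,z_{ip})$ i.i.d. $N(\boldsymbol 0,\boldsymbol C_0)$, where $\Phi$ is the standard normal cdf and $F_j^{-1}(u)=\inf\{y\in\mathbb R: F_j(y)\ge u\}$; let $G^\infty_{\boldsymbol C_0,F_1,\dots,F_p}$ be the distribution of $\{\boldsymbol y_i\}_{i=1}^\infty$. For data $\boldsymbol Y^{(n)}=(\boldsymbol y_1,\dots,\boldsymbol y_n)$ put $$D(\boldsymbol Y^{(n)})=\{\boldsymbol Z=(z_{ij})_{1\le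 i\le n,\,1\le j\le p}:\ y_{ij}<y_{i'j}\Rightarrow z_{ij}<z_{i'j}\ \text{ for all } i,i',j\},$$ and let the posterior under the extended rank likelihood be $$\Pi(\boldsymbol C\in\mathcal A\mid \boldsymbol Z^{(n)}\in D(\boldsymbol Y^{(n)}))=\frac{\int_{\mathcal A}P(\boldsymbol Z^{(n)}\in D(\boldsymbol Y^{(n)})\mid\boldsymbol C)\,\Pi(d\boldsymbol C)}{\int_{\mathcal C}P(\boldsymbol Z^{(n)}\in D(\boldsymbol Y^{(n)})\mid\boldsymbol C)\,\Pi(d\boldsymbol C)},$$ where, given $\boldsymbol C$ and with $\boldsymbol Y^{(n)}$ held fixed, $\boldsymbol Z^{(n)}$ consists of $n$ i.i.d. $N(\boldsymbol 0,\boldsymbol C)$ vectors. Then for $\nu$-almost every $\boldsymbol C_0\in\mathcal C$ and every neighbourhood $\mathcal A$ of $\boldsymbol C_0$, $$\lim_{n\to\infty}\Pi(\boldsymbol C\in\mathcal A\mid\boldsymbol Z^{(n)}\in D(\boldsymbol Y^{(n)}))=1\quad\text{almost surely }[G^\infty_{\boldsymbol C_0,F_1,\dots,F_p}].$$ -/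

import Mathlib

open MeasureTheory ProbabilityTheory Filter Topology
open scoped ENNReal

noncomputable section

/-- The space of all positive semidefinite (possibly singular) `p × p` correlation matrices. -/
def CorrMatrix (p : ℕ) : Type :=
  {C : Matrix (Fin p) (Fin p) ℝ // C.PosSemidef ∧ ∀ j, C j j = 1}

instance (p : ℕ) : TopologicalSpace (CorrMatrix p) :=
  inferInstanceAs (TopologicalSpace
    {C : Matrix (Fin p) (Fin p) ℝ // C.PosSemidef ∧ ∀ j, C j j = 1})

instance (p : ℕ) : MeasurableSpace (CorrMatrix p) := borel _

instance (p : ℕ) : BorelSpace (CorrMatrix p) := ⟨rfl⟩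

/-- The law `N(0, C)` of one latent vector `z = (z_1, …, z_p)`. -/
def latentLaw {p : ℕ} (C : CorrMatrix p) : Measure (Fin p → ℝ) :=
  (multivariateGaussian 0 C.1).map WithLp.ofLp

/-- The standard normal cdf `Φ`. -/
def stdNormalCDF (x : ℝ) : ℝ := cdf (gaussianReal 0 1) x

/-- The pseudo-inverse `F⁻¹(u) = inf {y : F(y) ≥ u}` of a cdf `F`. -/
def pseudoInverse (F : StieltjesFunction ℝ) (u : ℝ) : ℝ := sInf {y : ℝ | u ≤ F y}

/-- The observed vector `y_j = F_j⁻¹(Φ(z_j))` as a function of the latent vector `z`. -/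
def observe {p : ℕ} (F : Fin p → StieltjesFunction ℝ) (z : Fin p → ℝ) : Fin p → ℝ :=
  fun j => pseudoInverse (F j) (stdNormalCDF (z j))

/-- The law of one observation in the Gaussian copula model with copula correlation matrix `C`
and margins `F_1, …, F_p`. -/
def copulaLaw {p : ℕ} (C : CorrMatrix p) (F : Fin p → StieltjesFunction ℝ) :
    Measure (Fin p → ℝ) :=
  (latentLaw C).map (observe F)

/-- The law of the infinite i.i.d. sequence of observations `y_1, y_2, …`. -/
def dataLaw {p : ℕ} (C : CorrMatrix p) (F : Fin p → StieltjesFunction ℝ) :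
    Measure (ℕ → Fin p → ℝ) :=
  Measure.infinitePi fun _ => copulaLaw C F

/-- The set `D(Y)` of latent data `Z` compatible, in every coordinate, with the partial ordering
of the observed data `Y` (rows are observations, columns are variables). -/
def rankSet {n p : ℕ} (Y : Fin n → Fin p → ℝ) : Set (Fin n → Fin p → ℝ) :=
  {Z | ∀ j i i', Y i j < Y i' j → Z i j < Z i' j}

/-- The extended rank likelihood `P(Z ∈ D(Y) | C)`, for `n` i.i.d. latent vectors from
`N(0, C)`. -/
def rankLikelihood {n p : ℕ} (Y : Fin n → Fin p → ℝ) (C : CorrMatrix p) : ℝ≥0∞ :=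
  Measure.pi (fun _ : Fin n => latentLaw C) (rankSet Y)

/-- The posterior `Π(C ∈ · | Z ∈ D(Y))` given by Bayes' formula with the extended rank
likelihood. -/
def rankPosterior {n p : ℕ} (Pr : Measure (CorrMatrix p)) (Y : Fin n → Fin p → ℝ) :
    Measure (CorrMatrix p) :=
  (∫⁻ C, rankLikelihood Y C ∂Pr)⁻¹ • Pr.withDensity (rankLikelihood Y)

instance {p : ℕ} (C : CorrMatrix p) : IsProbabilityMeasure (latentLaw C) :=
  Measure.isProbabilityMeasure_map (WithLp.measurable_ofLp _ _).aemeasurable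

theorem stdNormalCDF_mem_Ioo (x : ℝ) : stdNormalCDF x ∈ Set.Ioo (0 : ℝ) 1 := by
  have hac := gaussianReal_absolutelyContinuous' 0 (v := 1) one_ne_zero
  have h0 : (gaussianReal 0 1).real (Set.Iic x) ≠ 0 := fun h => by
    have := hac ((measureReal_eq_zero_iff).1 h)
    simp at this
  have h1 : (gaussianReal 0 1).real (Set.Iic x)ᶜ ≠ 0 := fun h => by
    have := hac ((measureReal_eq_zero_iff).1 h)
    simp [Set.compl_Iic] at this
  rw [probReal_compl_eq_one_sub measurableSet_Iic] at h1
  unfold stdNormalCDF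
  rw [cdf_eq_real]
  have h2 := measureReal_nonneg (μ := gaussianReal 0 1) (s := Set.Iic x)
  have h3 := measureReal_le_one (μ := gaussianReal 0 1) (s := Set.Iic x)
  exact ⟨lt_of_le_of_ne h2 h0.symm, lt_of_le_of_ne h3 fun h => h1 (by rw [h, sub_self])⟩

theorem measurable_observe {p : ℕ} (F : Fin p → StieltjesFunction ℝ)
    (h0 : ∀ j, Tendsto (F j) atBot (𝓝 0)) (h1 : ∀ j, Tendsto (F j) atTop (𝓝 1)) :
    Measurable (observe F) := by
  refine measurable_pi_lambda _ fun j => ?_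
  have hm : Monotone fun x : ℝ => pseudoInverse (F j) (stdNormalCDF x) := by
    intro a b hab
    have hab' : stdNormalCDF a ≤ stdNormalCDF b := monotone_cdf _ hab
    refine csInf_le_csInf ?_ ?_ fun y hy => le_trans hab' hy
    · obtain ⟨y, hy⟩ := ((h0 j).eventually_lt_const (stdNormalCDF_mem_Ioo a).1).exists
      refine ⟨y, fun w hw => ?_⟩
      by_contra hc
      exact absurd (lt_of_le_of_lt ((F j).mono (le_of_lt (not_le.mp hc))) hy) (not_lt.mpr hw)
    · obtain ⟨y, hy⟩ := ((h1 j).eventually_const_lt (stdNormalCDF_mem_Ioo b).2).exists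
      exact ⟨y, hy.le⟩
  exact hm.measurable.comp (measurable_pi_apply j)

theorem isProbabilityMeasure_copulaLaw {p : ℕ} (C : CorrMatrix p)
    (F : Fin p → StieltjesFunction ℝ)
    (h0 : ∀ j, Tendsto (F j) atBot (𝓝 0)) (h1 : ∀ j, Tendsto (F j) atTop (𝓝 1)) :
    IsProbabilityMeasure (copulaLaw C F) :=
  Measure.isProbabilityMeasure_map (measurable_observe F h0 h1).aemeasurable

end

/-! Identifiability comes from dichotomizing. Nondegeneracy gives a threshold `t j` with `0 < F j (t
j) < 1`, and `y j ≤ t j` is the latent event `z j ≤ a j`. The probability that two latent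
coordinates lie below their thresholds is strictly increasing in their correlation, even at ±1
(`bivariateNormal_orthant_strictMonoOn`), so these orthant probabilities determine `C`
topologically.

Concentration has to cope with ties: different order patterns may be compatible with the same `Z`,
so the rank likelihood is not a probability mass function on patterns. It does dominate the true
probability of a pattern (`dataLaw_strictPattern_le`), and it overcounts only subexponentially. A
pattern is recovered from `Z` and the first and last members of each tie group
(`lt_iff_of_compatible`), and the number of distinct tied values is almost surely `o(n)`
(`ae_eventually_card_tiedValues_le`).

If `C` has orthant probabilities far from the observed frequencies, any compatible `Z` has atypical
latent frequencies, an event of probability `O(exp (-2η²n))` by Hoeffding. Hence the prior average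
of `∑ w, L_w(C) * Π(far | w)`, where the evidence cancels, is summable in `n`. So for almost every
`C₀` the expected posterior masses of the far sets are summable under the data law, and these masses
tend to 0 almost surely. The law of large numbers places the observed frequencies near those of
`C₀`. -/

/-! ### Measurable dependence of the latent normal law on the correlation matrix. -/

section LatentLaw

open scoped MatrixOrder

open scoped Matrix.Norms.L2Operator in
theorem continuous_sqrt_corrMatrix (p : ℕ) :
    Continuous fun C : CorrMatrix p => CFC.sqrt C.1 := by
  refine Continuous.cfcₙ_nnreal_of_mem_nhdsSet (s := Set.univ) NNReal.sqrt Filter.univ_mem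
    (continuous_subtype_val : Continuous fun C : CorrMatrix p => C.1)
    (fun C => C.2.1.nonneg) NNReal.continuous_sqrt.continuousOn NNReal.sqrt_zero

theorem continuous_sqrt_corrMatrix_apply {p : ℕ} (i j : Fin p) :
    Continuous fun C : CorrMatrix p => CFC.sqrt C.1 i j :=
  (continuous_apply j).comp ((continuous_apply i).comp (continuous_sqrt_corrMatrix p))

open Matrix in
theorem latentLaw_eq_map {p : ℕ} (C : CorrMatrix p) :
    latentLaw C = (Measure.pi fun _ : Fin p => gaussianReal 0 1).map
      fun x => CFC.sqrt C.1 *ᵥ x := by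
  rw [latentLaw, multivariateGaussian, ← map_pi_eq_stdGaussian, Measure.map_map, Measure.map_map]
  · congr 1
    ext x j
    simp
  all_goals fun_prop

/-- A singular `C` has no Lebesgue density. Instead `N(0, C)` is the image of one fixed Gaussian law
under `√C`, which is continuous in `C`, and measurability of sections applies. -/
theorem measurable_pi_latentLaw {p n : ℕ} {S : Set (Fin n → Fin p → ℝ)} (hS : MeasurableSet S) :
    Measurable fun C : CorrMatrix p => Measure.pi (fun _ : Fin n => latentLaw C) S := by
  have hm : Measurable fun q : CorrMatrix p × (Fin n → Fin p → ℝ) =>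
      fun i j => ∑ k, CFC.sqrt q.1.1 j k * q.2 i k := by
    refine measurable_pi_lambda _ fun i => measurable_pi_lambda _ fun j => ?_
    refine Finset.measurable_sum _ fun k _ => Measurable.mul ?_ ?_
    · exact (continuous_sqrt_corrMatrix_apply j k).measurable.comp measurable_fst
    · fun_prop
  have h := measurable_measure_prodMk_left
    (ν := Measure.pi fun _ : Fin n => Measure.pi fun _ : Fin p => gaussianReal 0 1) (hm hS)
  convert h using 2 with C
  have hf : Measurable fun x : Fin p → ℝ => Matrix.mulVec (CFC.sqrt C.1) x := by
    refine measurable_pi_lambda _ fun j => ?_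
    simp only [Matrix.mulVec, dotProduct]
    fun_prop
  simp_rw [latentLaw_eq_map]
  rw [← Measure.pi_map_pi (fun _ => hf.aemeasurable), Measure.map_apply (by fun_prop) hS]
  rfl

theorem measurable_latentLaw_apply {p : ℕ} {S : Set (Fin p → ℝ)} (hS : MeasurableSet S) :
    Measurable fun C : CorrMatrix p => latentLaw C S := by
  have h := measurable_pi_latentLaw (p := p) (n := 1)
    (S := (fun Z => Z 0) ⁻¹' S) ((measurable_pi_apply 0) hS)
  convert h using 2 with C
  rw [← Measure.map_apply (measurable_pi_apply 0) hS, Measure.pi_map_eval]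
  simp

theorem corrMatrix_apply_mem_Icc {p : ℕ} (C : CorrMatrix p) (j l : Fin p) :
    C.1 j l ∈ Set.Icc (-1 : ℝ) 1 := by
  have h (s : ℝ) := C.2.1.dotProduct_mulVec_nonneg (Pi.single j 1 + Pi.single l s)
  have hsymm : C.1 l j = C.1 j l := by simpa using C.2.1.1.apply j l
  have key (s : ℝ) : 0 ≤ 1 + 2 * s * C.1 j l + s ^ 2 := by
    have := h s
    simp only [Matrix.mulVec_add, star_trivial, add_dotProduct, dotProduct_add,
      Matrix.mulVec_single, single_dotProduct, op_smul_eq_smul, Pi.smul_apply,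
      Matrix.col_apply, smul_eq_mul, C.2.2, hsymm] at this
    nlinarith
  constructor
  · have := key 1; linarith
  · have := key (-1); linarith

end LatentLaw

/-! ### Bivariate normal orthant probabilities and identifiability of `C`. -/

section BivariateNormal

/-- `μ` has the characteristic function of the centred bivariate normal law with unit variances
and correlation `ρ`. -/
def HasBivariateNormalCharFun (μ : Measure (ℝ × ℝ)) (ρ : ℝ) : Prop :=
  ∀ s t : ℝ, ∫ x, Complex.exp (((s * x.1 + t * x.2 : ℝ) : ℂ) * Complex.I) ∂μ =
    Complex.exp (((-(s ^ 2 + 2 * ρ * s * t + t ^ 2) / 2 : ℝ) : ℂ))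

theorem HasBivariateNormalCharFun.unique {μ ν : Measure (ℝ × ℝ)} [IsFiniteMeasure μ]
    [IsFiniteMeasure ν] {ρ : ℝ} (hμ : HasBivariateNormalCharFun μ ρ)
    (hν : HasBivariateNormalCharFun ν ρ) : μ = ν := by
  refine Measure.ext_of_charFunDual ?_
  ext L
  have hL (x : ℝ × ℝ) : L x = L (1, 0) * x.1 + L (0, 1) * x.2 := by
    have : x = x.1 • ((1 : ℝ), (0 : ℝ)) + x.2 • ((0 : ℝ), (1 : ℝ)) := by ext <;> simp
    conv_lhs => rw [this]
    rw [map_add, map_smul, map_smul, smul_eq_mul, smul_eq_mul]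
    ring
  rw [charFunDual_apply, charFunDual_apply, integral_congr_ae (ae_of_all μ fun x => by rw [hL x]),
    integral_congr_ae (ae_of_all ν fun x => by rw [hL x])]
  exact (hμ _ _).trans (hν _ _).symm

theorem integral_exp_mul_gaussianReal (u : ℝ) :
    ∫ x, Complex.exp (((u * x : ℝ) : ℂ) * Complex.I) ∂(gaussianReal 0 1) =
      Complex.exp ((-u ^ 2 / 2 : ℝ) : ℂ) := by
  have h := charFun_gaussianReal (μ := 0) (v := 1) u
  rw [charFun_apply_real] at h
  simp only [Complex.ofReal_mul]
  rw [h]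
  congr 1
  push_cast
  ring

/-- The law of the pair `(aS + bT + cN, aS - bT + dN)` for independent standard normal
`S`, `T`, `N`. -/
noncomputable def normalPairLaw (a b c d : ℝ) : Measure (ℝ × ℝ) :=
  (((gaussianReal 0 1).prod (gaussianReal 0 1)).prod (gaussianReal 0 1)).map fun q =>
    (a * q.1.1 + b * q.1.2 + c * q.2, a * q.1.1 - b * q.1.2 + d * q.2)

instance (a b c d : ℝ) : IsProbabilityMeasure (normalPairLaw a b c d) :=
  Measure.isProbabilityMeasure_map (Measurable.aemeasurable (by fun_prop))

theorem hasBivariateNormalCharFun_normalPairLaw {a b c d ρ : ℝ}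
    (h1 : a ^ 2 + b ^ 2 + c ^ 2 = 1) (h2 : a ^ 2 + b ^ 2 + d ^ 2 = 1)
    (h3 : a ^ 2 - b ^ 2 + c * d = ρ) :
    HasBivariateNormalCharFun (normalPairLaw a b c d) ρ := by
  intro s t
  rw [normalPairLaw, integral_map (Measurable.aemeasurable (by fun_prop))
    (Measurable.aestronglyMeasurable (by fun_prop))]
  have hsplit (q : (ℝ × ℝ) × ℝ) :
      Complex.exp (((s * (a * q.1.1 + b * q.1.2 + c * q.2) +
        t * (a * q.1.1 - b * q.1.2 + d * q.2) : ℝ) : ℂ) * Complex.I) =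
      (Complex.exp ((((s + t) * a * q.1.1 : ℝ) : ℂ) * Complex.I) *
        Complex.exp ((((s - t) * b * q.1.2 : ℝ) : ℂ) * Complex.I)) *
        Complex.exp ((((s * c + t * d) * q.2 : ℝ) : ℂ) * Complex.I) := by
    rw [← Complex.exp_add, ← Complex.exp_add]
    congr 1
    push_cast
    ring
  simp_rw [hsplit]
  rw [integral_prod_mul (fun q : ℝ × ℝ =>
      Complex.exp ((((s + t) * a * q.1 : ℝ) : ℂ) * Complex.I) *
        Complex.exp ((((s - t) * b * q.2 : ℝ) : ℂ) * Complex.I))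
      (fun x : ℝ => Complex.exp ((((s * c + t * d) * x : ℝ) : ℂ) * Complex.I)),
    integral_prod_mul (fun x : ℝ => Complex.exp ((((s + t) * a * x : ℝ) : ℂ) * Complex.I))
      (fun x : ℝ => Complex.exp ((((s - t) * b * x : ℝ) : ℂ) * Complex.I)),
    integral_exp_mul_gaussianReal, integral_exp_mul_gaussianReal, integral_exp_mul_gaussianReal,
    ← Complex.exp_add, ← Complex.exp_add, ← Complex.ofReal_add, ← Complex.ofReal_add]
  congr 2
  rw [← h3]
  linear_combination (-s ^ 2 / 2) * h1 - (t ^ 2 / 2) * h2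

open Matrix in
theorem hasBivariateNormalCharFun_latentLaw {p : ℕ} (C : CorrMatrix p) (j l : Fin p) :
    HasBivariateNormalCharFun ((latentLaw C).map fun z => (z j, z l)) (C.1 j l) := by
  intro s t
  have h := charFun_multivariateGaussian (μ := 0) C.2.1
    (WithLp.toLp 2 (Pi.single j s + Pi.single l t))
  have hsymm : C.1 l j = C.1 j l := by simpa using C.2.1.1.apply j l
  rw [integral_map (by fun_prop) (Measurable.aestronglyMeasurable (by fun_prop)), latentLaw,
    integral_map (by fun_prop) (Measurable.aestronglyMeasurable (by fun_prop))]
  rw [charFun_apply] at h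
  convert h using 1
  · refine integral_congr_ae (ae_of_all _ fun x => ?_)
    simp only [PiLp.inner_apply, Pi.add_apply, RCLike.inner_apply, conj_trivial]
    simp [add_mul, Finset.sum_add_distrib, Pi.single_apply]
  · congr 1
    simp only [Matrix.mulVec_add, add_dotProduct, dotProduct_add,
      Matrix.mulVec_single, single_dotProduct, op_smul_eq_smul, Pi.smul_apply,
      Matrix.col_apply, smul_eq_mul, C.2.2, hsymm, inner_zero_right]
    push_cast
    ring

theorem gaussianReal_Iio_pos (x : ℝ) : 0 < gaussianReal 0 1 (Set.Iio x) := by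
  refine pos_iff_ne_zero.2 fun h => ?_
  have := gaussianReal_absolutelyContinuous' 0 (v := 1) one_ne_zero h
  simp at this

/-- Comonotone normal pairs charge lower orthants strictly more than antithetic ones. -/
theorem gaussianReal_antithetic_lt (u v : ℝ) :
    gaussianReal 0 1 {n | n ≤ u ∧ -n ≤ v} < gaussianReal 0 1 {n | n ≤ u ∧ n ≤ v} := by
  have key (u v : ℝ) (huv : u ≤ v) :
      gaussianReal 0 1 {n | n ≤ u ∧ -n ≤ v} < gaussianReal 0 1 {n | n ≤ u ∧ n ≤ v} := by
    -- For `u ≤ v` the comonotone event is `n ≤ u`, while the antithetic one also requires `-v ≤ n`.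
    -- The part lost contains a half-line, which has positive mass.
    have hdisj : Disjoint {n : ℝ | n ≤ u ∧ -n ≤ v} (Set.Iio (min (-v) u)) := by
      rw [Set.disjoint_left]
      intro n hn hn'
      have := lt_of_lt_of_le (Set.mem_Iio.1 hn') (min_le_left _ _)
      linarith [hn.2]
    calc gaussianReal 0 1 {n | n ≤ u ∧ -n ≤ v}
        < gaussianReal 0 1 {n | n ≤ u ∧ -n ≤ v} + gaussianReal 0 1 (Set.Iio (min (-v) u)) :=
          ENNReal.lt_add_right (measure_ne_top _ _) (gaussianReal_Iio_pos _).ne'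
      _ = gaussianReal 0 1 ({n | n ≤ u ∧ -n ≤ v} ∪ Set.Iio (min (-v) u)) :=
          (measure_union hdisj measurableSet_Iio).symm
      _ ≤ _ := measure_mono fun n hn => by
          rcases hn with hn | hn
          · exact ⟨hn.1, hn.1.trans huv⟩
          · have := (lt_of_lt_of_le (Set.mem_Iio.1 hn) (min_le_right _ _)).le
            exact ⟨this, this.trans huv⟩
  rcases le_total u v with huv | huv
  · exact key u v huv
  · have hneg : (gaussianReal 0 1).map (fun x => -x) = gaussianReal 0 1 := by
      rw [gaussianReal_map_neg, neg_zero]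
    have h := key v u huv
    have h1 : gaussianReal 0 1 {n | n ≤ v ∧ -n ≤ u} = gaussianReal 0 1 {n | n ≤ u ∧ -n ≤ v} := by
      conv_lhs => rw [← hneg]
      have hS : MeasurableSet {n : ℝ | n ≤ v ∧ -n ≤ u} :=
        measurableSet_Iic.inter (measurableSet_le measurable_neg measurable_const)
      rw [Measure.map_apply (by fun_prop) hS]
      congr 1
      ext n
      simp [and_comm]
    have h2 : {n : ℝ | n ≤ v ∧ n ≤ u} = {n | n ≤ u ∧ n ≤ v} := by ext; simp [and_comm]
    rwa [h1, h2] at h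

theorem normalPairLaw_orthant_lt (a b : ℝ) {c : ℝ} (hc : 0 < c) (x y : ℝ) :
    normalPairLaw a b c (-c) (Set.Iic x ×ˢ Set.Iic y) <
      normalPairLaw a b c c (Set.Iic x ×ˢ Set.Iic y) := by
  have hS : MeasurableSet (Set.Iic x ×ˢ Set.Iic y) := measurableSet_Iic.prod measurableSet_Iic
  have hm (d : ℝ) : Measurable fun q : (ℝ × ℝ) × ℝ =>
    (a * q.1.1 + b * q.1.2 + c * q.2, a * q.1.1 - b * q.1.2 + d * q.2) := by fun_prop
  rw [normalPairLaw, normalPairLaw, Measure.map_apply (hm _) hS, Measure.map_apply (hm _) hS,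
    Measure.prod_apply (hm _ hS), Measure.prod_apply (hm _ hS)]
  refine lintegral_strict_mono (NeZero.ne _) (measurable_measure_prodMk_left (hm _ hS)).aemeasurable
    ?_ (ae_of_all _ fun q => ?_)
  · exact ((lintegral_mono fun _ => prob_le_one).trans_lt (by simp)).ne
  · convert gaussianReal_antithetic_lt ((x - (a * q.1 + b * q.2)) / c)
      ((y - (a * q.1 - b * q.2)) / c) using 2 <;>
    · ext n
      simp only [Set.mem_preimage, Set.mem_prod, Set.mem_Iic, Set.mem_ofPred_eq, le_div_iff₀ hc]
      constructor <;> rintro ⟨h1, h2⟩ <;> constructor <;> linarith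

/-- The centred bivariate normal law with unit variances and correlation `ρ ∈ [-1, 1]`. -/
noncomputable def bivariateNormal (ρ : ℝ) : Measure (ℝ × ℝ) :=
  normalPairLaw √((1 + ρ) / 2) √((1 - ρ) / 2) 0 0

instance (ρ : ℝ) : IsProbabilityMeasure (bivariateNormal ρ) := by
  unfold bivariateNormal; infer_instance

theorem hasBivariateNormalCharFun_bivariateNormal {ρ : ℝ} (hρ : ρ ∈ Set.Icc (-1 : ℝ) 1) :
    HasBivariateNormalCharFun (bivariateNormal ρ) ρ := by
  have h1 : √((1 + ρ) / 2) ^ 2 = (1 + ρ) / 2 := Real.sq_sqrt (by linarith [hρ.1])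
  have h2 : √((1 - ρ) / 2) ^ 2 = (1 - ρ) / 2 := Real.sq_sqrt (by linarith [hρ.2])
  apply hasBivariateNormalCharFun_normalPairLaw <;> rw [h1, h2] <;> ring

/-- A coupling argument: for `r < s` both laws are built from the same `S`, `T`, `N`, with `N`
entering the second coordinate with sign `-` for `r` and `+` for `s`. Conditionally on `S` and `T`,
the comparison is that of comonotone and antithetic pairs. No density is used, so the degenerate
correlations ±1 are included. -/
theorem bivariateNormal_orthant_strictMonoOn (x y : ℝ) :
    StrictMonoOn (fun ρ => bivariateNormal ρ (Set.Iic x ×ˢ Set.Iic y)) (Set.Icc (-1 : ℝ) 1) := by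
  intro r hr s hs hrs
  have h1 : √((1 + r) / 2) ^ 2 = (1 + r) / 2 := Real.sq_sqrt (by linarith [hr.1])
  have h2 : √((1 - s) / 2) ^ 2 = (1 - s) / 2 := Real.sq_sqrt (by linarith [hs.2])
  have h3 : √((s - r) / 2) ^ 2 = (s - r) / 2 := Real.sq_sqrt (by linarith)
  have hc : 0 < √((s - r) / 2) := Real.sqrt_pos.2 (by linarith)
  have e1 : bivariateNormal r =
      normalPairLaw √((1 + r) / 2) √((1 - s) / 2) √((s - r) / 2) (-√((s - r) / 2)) := by
    refine (hasBivariateNormalCharFun_bivariateNormal hr).unique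
      (hasBivariateNormalCharFun_normalPairLaw ?_ ?_ ?_)
    · rw [h1, h2, h3]; ring
    · rw [neg_sq, h1, h2, h3]; ring
    · rw [mul_neg, ← sq, h1, h2, h3]; ring
  have e2 : bivariateNormal s =
      normalPairLaw √((1 + r) / 2) √((1 - s) / 2) √((s - r) / 2) √((s - r) / 2) := by
    refine (hasBivariateNormalCharFun_bivariateNormal hs).unique
      (hasBivariateNormalCharFun_normalPairLaw ?_ ?_ ?_)
    · rw [h1, h2, h3]; ring
    · rw [h1, h2, h3]; ring
    · rw [← sq, h1, h2, h3]; ring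
  simp only [e1, e2]
  exact normalPairLaw_orthant_lt _ _ hc x y

/-- The probability that the latent coordinates `j` and `l` lie below the thresholds
`a j` and `a l`. -/
noncomputable def orthantProb {p : ℕ} (a : Fin p → ℝ) (C : CorrMatrix p) (j l : Fin p) : ℝ :=
  (latentLaw C).real {z | z j ≤ a j ∧ z l ≤ a l}

theorem measurableSet_orthant {p : ℕ} (a : Fin p → ℝ) (j l : Fin p) :
    MeasurableSet {z : Fin p → ℝ | z j ≤ a j ∧ z l ≤ a l} :=
  (measurableSet_le (measurable_pi_apply j) measurable_const).inter
    (measurableSet_le (measurable_pi_apply l) measurable_const)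

theorem measurable_orthantProb {p : ℕ} (a : Fin p → ℝ) (j l : Fin p) :
    Measurable fun C : CorrMatrix p => orthantProb a C j l :=
  (measurable_latentLaw_apply (measurableSet_orthant a j l)).ennreal_toReal

theorem orthantProb_eq {p : ℕ} (a : Fin p → ℝ) (C : CorrMatrix p) (j l : Fin p) :
    orthantProb a C j l = (bivariateNormal (C.1 j l)).real (Set.Iic (a j) ×ˢ Set.Iic (a l)) := by
  have : (latentLaw C).map (fun z => (z j, z l)) = bivariateNormal (C.1 j l) := by
    have : IsProbabilityMeasure ((latentLaw C).map fun z => (z j, z l)) :=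
      Measure.isProbabilityMeasure_map (by fun_prop)
    exact (hasBivariateNormalCharFun_latentLaw C j l).unique
      (hasBivariateNormalCharFun_bivariateNormal (corrMatrix_apply_mem_Icc C j l))
  rw [← this, map_measureReal_apply (by fun_prop) (measurableSet_Iic.prod measurableSet_Iic)]
  rfl

/-- The inverse of a strictly monotone function on an interval is continuous, whether or not the
function is. On a side where `x ± r` leaves the interval there is nothing to separate, and any `ε`
serves. -/
theorem StrictMonoOn.exists_abs_sub_lt {f : ℝ → ℝ} {s : Set ℝ} (hs : s.OrdConnected)
    (hf : StrictMonoOn f s) {x r : ℝ} (hx : x ∈ s) (hr : 0 < r) :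
    ∃ ε > 0, ∀ y ∈ s, |f y - f x| ≤ ε → |y - x| < r := by
  have hup : ∃ ε > 0, ∀ y ∈ s, |f y - f x| ≤ ε → y < x + r := by
    by_cases h : x + r ∈ s
    · have := hf hx h (by linarith)
      refine ⟨(f (x + r) - f x) / 2, by linarith, fun y hy hyx => ?_⟩
      by_contra! hc
      have h2 := hf.monotoneOn h hy hc
      linarith [(abs_le.1 hyx).2]
    · refine ⟨1, one_pos, fun y hy _ => ?_⟩
      by_contra! hc
      exact h (hs.out hx hy ⟨by linarith, hc⟩)
  have hdown : ∃ ε > 0, ∀ y ∈ s, |f y - f x| ≤ ε → x - r < y := by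
    by_cases h : x - r ∈ s
    · have := hf h hx (by linarith)
      refine ⟨(f x - f (x - r)) / 2, by linarith, fun y hy hyx => ?_⟩
      by_contra! hc
      have h2 := hf.monotoneOn hy h hc
      linarith [(abs_le.1 hyx).1]
    · refine ⟨1, one_pos, fun y hy _ => ?_⟩
      by_contra! hc
      exact h (hs.out hy hx ⟨hc, by linarith⟩)
  obtain ⟨ε₁, h1, h1'⟩ := hup
  obtain ⟨ε₂, h2, h2'⟩ := hdown
  refine ⟨min ε₁ ε₂, lt_min h1 h2, fun y hy hyx => ?_⟩
  have := h1' y hy (hyx.trans (min_le_left _ _))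
  have := h2' y hy (hyx.trans (min_le_right _ _))
  rw [abs_lt]
  constructor <;> linarith

theorem exists_forall_abs_orthantProb_sub_le_imp_mem {p : ℕ} (a : Fin p → ℝ) {C₀ : CorrMatrix p}
    {A : Set (CorrMatrix p)} (hA : A ∈ 𝓝 C₀) :
    ∃ ε > 0, ∀ C, (∀ j l, |orthantProb a C j l - orthantProb a C₀ j l| ≤ ε) → C ∈ A := by
  obtain ⟨r, hr, hrA⟩ : ∃ r > 0, ∀ C : CorrMatrix p, (∀ j l, |C.1 j l - C₀.1 j l| < r) → C ∈ A := by
    have hind : IsInducing fun C : CorrMatrix p => (C.1 : Fin p → Fin p → ℝ) :=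
      IsInducing.subtypeVal
    rw [hind.nhds_eq_comap] at hA
    obtain ⟨U, hU, hUA⟩ := hA
    obtain ⟨r, hr, h⟩ := Metric.mem_nhds_iff.1
      (show U ∈ @nhds (Fin p → Fin p → ℝ) _ C₀.1 from hU)
    refine ⟨r, hr, fun C hC => hUA (h ?_)⟩
    refine (dist_pi_lt_iff hr).2 fun j => (dist_pi_lt_iff hr).2 fun l => ?_
    rw [Real.dist_eq]
    exact hC j l
  have h (j l : Fin p) : ∃ ε > 0, ∀ C : CorrMatrix p,
      |orthantProb a C j l - orthantProb a C₀ j l| ≤ ε → |C.1 j l - C₀.1 j l| < r := by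
    have hmono : StrictMonoOn (fun ρ => (bivariateNormal ρ).real (Set.Iic (a j) ×ˢ Set.Iic (a l)))
        (Set.Icc (-1 : ℝ) 1) := fun r hr s hs hrs =>
      (ENNReal.toReal_lt_toReal (measure_ne_top _ _) (measure_ne_top _ _)).2
        (bivariateNormal_orthant_strictMonoOn (a j) (a l) hr hs hrs)
    obtain ⟨ε, hε, hε'⟩ := hmono.exists_abs_sub_lt Set.ordConnected_Icc
      (corrMatrix_apply_mem_Icc C₀ j l) hr
    refine ⟨ε, hε, fun C hC => hε' _ (corrMatrix_apply_mem_Icc C j l) ?_⟩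
    rwa [orthantProb_eq, orthantProb_eq] at hC
  choose ε hε hε' using h
  have : ∃ δ > 0, ∀ j l, δ ≤ ε j l := by
    have h1 : ∀ᶠ δ in 𝓝[>] (0 : ℝ), ∀ j l, δ ≤ ε j l := eventually_all.2 fun j =>
      eventually_all.2 fun l => eventually_nhdsWithin_of_eventually_nhds
        (eventually_le_nhds (hε j l))
    obtain ⟨δ, h, hδ⟩ := (h1.and self_mem_nhdsWithin).exists
    exact ⟨δ, hδ, h⟩
  obtain ⟨δ, hδ, hδ'⟩ := this
  exact ⟨δ, hδ, fun C hC => hrA C fun j l => hε' j l C ((hC j l).trans (hδ' j l))⟩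

end BivariateNormal

/-! ### Encoding a weak order by a compatible linear order and few marked elements. -/

section TieStructure

open scoped Classical in
/-- The values attained at least twice by a finite family. -/
noncomputable def tiedValues {ι : Type*} [Fintype ι] (y : ι → ℝ) : Finset ℝ :=
  ({i | ∃ k, k ≠ i ∧ y k = y i} : Finset ι).image y

open scoped Classical in
/-- The `z`-minimal elements of the nontrivial tie groups of `y`. -/
noncomputable def firstTied {ι : Type*} [Fintype ι] (y z : ι → ℝ) : Finset ι :=
  {i | (∃ k, k ≠ i ∧ y k = y i) ∧ ∀ k, y k = y i → z i ≤ z k}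

theorem card_firstTied_le {ι : Type*} [Fintype ι] (y : ι → ℝ) {z : ι → ℝ}
    (hz : Function.Injective z) : (firstTied y z).card ≤ (tiedValues y).card := by
  classical
  refine Finset.card_le_card_of_injOn y (fun i hi => ?_) fun i hi k hk hik => ?_
  · simp only [firstTied, Finset.coe_filter, Finset.mem_univ, true_and, Set.mem_ofPred_eq] at hi
    exact Finset.mem_image_of_mem _ (by simpa using hi.1)
  · simp only [firstTied, Finset.coe_filter, Finset.mem_univ, true_and, Set.mem_ofPred_eq] at hi hk
    exact hz (le_antisymm (hi.2 k hik.symm) (hk.2 i hik))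

theorem exists_mem_firstTied {ι : Type*} [Fintype ι] (y z : ι → ℝ) {i : ι}
    (hi : ∃ k, k ≠ i ∧ y k = y i) : ∃ a ∈ firstTied y z, y a = y i ∧ z a ≤ z i := by
  classical
  obtain ⟨a, ha, hmin⟩ := Finset.exists_min_image ({k | y k = y i} : Finset ι) z ⟨i, by simp⟩
  simp only [Finset.mem_filter, Finset.mem_univ, true_and] at ha hmin
  refine ⟨a, ?_, ha, hmin i rfl⟩
  simp only [firstTied, Finset.mem_filter, Finset.mem_univ, true_and]
  refine ⟨?_, fun k hk => hmin k (hk.trans ha)⟩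
  by_cases hai : a = i
  · subst hai; exact hi
  · exact ⟨i, Ne.symm hai, ha.symm⟩

/-- The strict weak order induced by `y` is recovered from a compatible `z` and the
first and last elements of the nontrivial tie groups. -/
theorem lt_iff_of_compatible {ι : Type*} [Fintype ι] {y z : ι → ℝ}
    (hyz : ∀ i k, y i < y k → z i < z k) (i k : ι) :
    y i < y k ↔ z i < z k ∧ ¬ ∃ a ∈ firstTied y z, z a ≤ z i ∧
      ∀ b ∈ firstTied y (-z), z a ≤ z b → z k ≤ z b := by
  have hle {i k : ι} (h : z i ≤ z k) : y i ≤ y k := by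
    by_contra! hc
    exact absurd (hyz _ _ hc) (not_lt.2 h)
  -- The nontrivial tie groups occupy disjoint blocks in the `z`-order. The excluded clause says
  -- that some block starts at or before `i` and that no block end from there on precedes `k`, so
  -- `i` and `k` share a block.
  constructor
  · refine fun hik => ⟨hyz _ _ hik, ?_⟩
    rintro ⟨a, ha, hai, hb⟩
    have ha' := ha
    simp only [firstTied, Finset.mem_filter, Finset.mem_univ, true_and] at ha'
    obtain ⟨b, hbm, hba, hzb⟩ := exists_mem_firstTied y (-z) ha'.1
    simp only [Pi.neg_apply, neg_le_neg_iff] at hzb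
    have h1 := hle (hb b hbm hzb)
    have h2 := hle hai
    linarith
  · rintro ⟨hik, hne⟩
    refine lt_of_le_of_ne (hle hik.le) fun heq => hne ?_
    have hne' : i ≠ k := fun h => by simp [h] at hik
    obtain ⟨a, ha, hai, hza⟩ := exists_mem_firstTied y z ⟨k, hne'.symm, heq.symm⟩
    refine ⟨a, ha, hza, fun b hb hab => ?_⟩
    simp only [firstTied, Finset.mem_filter, Finset.mem_univ, true_and, Pi.neg_apply,
      neg_le_neg_iff] at hb
    by_contra! hc
    have h1 := hle hab
    have h2 := hle hc.le
    exact absurd (hb.2 k (by linarith)) (not_le.2 hc)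

/-- Exponential weighting: `∑ A, x ^ #A = (1 + x) ^ n ≤ exp (δn/2)` when `x ≤ δ/2`, and `κ` is
chosen so that each small `A` contributes at least `exp (-δn/2)`. -/
theorem exists_forall_card_filter_card_le_exp {δ : ℝ} (hδ : 0 < δ) :
    ∃ κ > 0, ∀ n : ℕ, ((Finset.univ.filter fun A : Finset (Fin n) => (A.card : ℝ) ≤ κ * n).card : ℝ)
      ≤ Real.exp (δ * n) := by
  set x : ℝ := min (δ / 2) (1 / 2) with hx
  have hx0 : 0 < x := lt_min (by linarith) (by norm_num)
  have hx1 : x < 1 := (min_le_right _ _).trans_lt (by norm_num)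
  have hlog : Real.log x < 0 := Real.log_neg hx0 hx1
  refine ⟨δ / 2 / (-Real.log x), by apply div_pos <;> linarith, fun n => ?_⟩
  have hsum : ∑ A : Finset (Fin n), x ^ A.card = (x + 1) ^ n := by
    have := Finset.sum_pow_mul_eq_add_pow x 1 (Finset.univ : Finset (Fin n))
    simpa using this
  have hterm (A : Finset (Fin n)) (hA : (A.card : ℝ) ≤ δ / 2 / (-Real.log x) * n) :
      Real.exp (-(δ / 2 * n)) ≤ x ^ A.card := by
    rw [← Real.rpow_natCast, Real.rpow_def_of_pos hx0, Real.exp_le_exp]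
    have : δ / 2 / (-Real.log x) * n * (-Real.log x) = δ / 2 * n := by
      have := hlog.ne
      field_simp
    nlinarith
  have h1 : ((Finset.univ.filter fun A : Finset (Fin n) =>
      (A.card : ℝ) ≤ δ / 2 / (-Real.log x) * n).card : ℝ) * Real.exp (-(δ / 2 * n)) ≤
      Real.exp (δ / 2 * n) := by
    calc _ = ∑ A ∈ Finset.univ.filter fun A : Finset (Fin n) =>
            (A.card : ℝ) ≤ δ / 2 / (-Real.log x) * n, Real.exp (-(δ / 2 * n)) := by simp
      _ ≤ ∑ A ∈ Finset.univ.filter fun A : Finset (Fin n) =>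
            (A.card : ℝ) ≤ δ / 2 / (-Real.log x) * n, x ^ A.card :=
          Finset.sum_le_sum fun A hA => hterm A (by simpa using hA)
      _ ≤ ∑ A : Finset (Fin n), x ^ A.card :=
          Finset.sum_le_sum_of_subset_of_nonneg (Finset.filter_subset _ _)
            fun _ _ _ => by positivity
      _ = (x + 1) ^ n := hsum
      _ ≤ (Real.exp (δ / 2)) ^ n := by
          gcongr
          exact (add_le_add_left (min_le_left _ _) 1).trans (Real.add_one_le_exp _)
      _ = Real.exp (δ / 2 * n) := by rw [← Real.exp_nat_mul]; ring_nf
  rw [Real.exp_neg, ← div_eq_mul_inv, div_le_iff₀ (Real.exp_pos _), ← Real.exp_add] at h1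
  rwa [← add_mul, add_halves] at h1

end TieStructure

/-! ### Order patterns of data matrices and their compatible latent data. -/

section Patterns

/-- The strict orders induced by the columns of a data matrix. -/
def strictPattern {n p : ℕ} (Y : Fin n → Fin p → ℝ) : Fin p → Fin n → Fin n → Prop :=
  fun j i k => Y i j < Y k j

/-- The latent data matrices compatible with a family of relations between observations. -/
def compatibleSet {n p : ℕ} (w : Fin p → Fin n → Fin n → Prop) : Set (Fin n → Fin p → ℝ) :=
  {Z | ∀ j i k, w j i k → Z i j < Z k j}

theorem measurableSet_compatibleSet {n p : ℕ} (w : Fin p → Fin n → Fin n → Prop) :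
    MeasurableSet (compatibleSet w) := by
  simp only [compatibleSet, Set.ofPred_forall]
  refine MeasurableSet.iInter fun j => MeasurableSet.iInter fun i => MeasurableSet.iInter fun k =>
    MeasurableSet.iInter fun _ => measurableSet_lt ?_ ?_ <;> fun_prop

theorem measurableSet_strictPattern_eq {n p : ℕ} (w : Fin p → Fin n → Fin n → Prop) :
    MeasurableSet {Y : Fin n → Fin p → ℝ | strictPattern Y = w} := by
  have : {Y : Fin n → Fin p → ℝ | strictPattern Y = w} =
      ⋂ j, ⋂ i, ⋂ k, {Y | Y i j < Y k j ↔ w j i k} := by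
    ext Y
    simp only [strictPattern, funext_iff, Set.mem_ofPred_eq, Set.mem_iInter, eq_iff_iff]
  rw [this]
  refine MeasurableSet.iInter fun j => MeasurableSet.iInter fun i => MeasurableSet.iInter fun k => ?_
  have hm : MeasurableSet {Y : Fin n → Fin p → ℝ | Y i j < Y k j} :=
    measurableSet_lt (by fun_prop) (by fun_prop)
  by_cases h : w j i k
  · simpa [h] using hm
  · have : {Y : Fin n → Fin p → ℝ | Y i j < Y k j ↔ w j i k} = {Y | Y i j < Y k j}ᶜ := by
      ext Y; simp [h]
    rw [this]
    exact hm.compl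

/-- The number of rows lying below the threshold `t` in both coordinates `j` and `l`. -/
noncomputable def belowCount {n p : ℕ} (t : Fin p → ℝ) (Y : Fin n → Fin p → ℝ) (j l : Fin p) : ℕ :=
  (Finset.univ.filter fun i => Y i j ≤ t j ∧ Y i l ≤ t l).card

/-- Data whose columns have few tied values and whose numbers of rows below the thresholds `t`
are close to `n * g`. -/
structure IsTypical {p : ℕ} (t g : Fin p → ℝ) (κ η : ℝ) {n : ℕ} (Y : Fin n → Fin p → ℝ) :
    Prop where
  card_tiedValues_le : ∀ j, ((tiedValues fun i => Y i j).card : ℝ) ≤ κ * n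
  abs_belowCount_sub_le : ∀ j, |(belowCount t Y j j : ℝ) - n * g j| ≤ η * n

/-- Given `Z`, each column of a pattern is decoded from two small index sets, the first and the last
members of its tie groups, hence the exponent `2 * p`. What must be small is the number of tied
values, not of tied observations, so discrete margins are allowed. -/
theorem ncard_strictPattern_compatible_le {n p : ℕ} {κ : ℝ} {Z : Fin n → Fin p → ℝ}
    (hZ : ∀ j, Function.Injective fun i => Z i j) (P : (Fin n → Fin p → ℝ) → Prop)
    (hP : ∀ Y, P Y → ∀ j, ((tiedValues fun i => Y i j).card : ℝ) ≤ κ * n) :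
    {w | Z ∈ compatibleSet w ∧ ∃ Y, P Y ∧ strictPattern Y = w}.ncard ≤
      (Finset.univ.filter fun A : Finset (Fin n) => (A.card : ℝ) ≤ κ * n).card ^ (2 * p) := by
  classical
  set S := Finset.univ.filter fun A : Finset (Fin n) => (A.card : ℝ) ≤ κ * n
  let decode (A : Fin p → Finset (Fin n) × Finset (Fin n)) : Fin p → Fin n → Fin n → Prop :=
    fun j i k => Z i j < Z k j ∧ ¬ ∃ a ∈ (A j).1, Z a j ≤ Z i j ∧
      ∀ b ∈ (A j).2, Z a j ≤ Z b j → Z k j ≤ Z b j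
  have hsub : {w | Z ∈ compatibleSet w ∧ ∃ Y, P Y ∧ strictPattern Y = w} ⊆
      decode '' (Fintype.piFinset fun _ : Fin p => S ×ˢ S : Finset _) := by
    rintro w ⟨hZw, Y, hY, rfl⟩
    refine ⟨fun j => (firstTied (fun i => Y i j) fun i => Z i j,
      firstTied (fun i => Y i j) (-fun i => Z i j)), ?_, ?_⟩
    · refine Finset.mem_coe.2 (Fintype.mem_piFinset.2 fun j => Finset.mem_product.2 ?_)
      have hinj : Function.Injective (-fun i => Z i j) := fun a b hab => hZ j (neg_injective hab)
      simp only [S, Finset.mem_filter, Finset.mem_univ, true_and]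
      constructor
      · exact (Nat.cast_le.2 (card_firstTied_le _ (hZ j))).trans (hP Y hY j)
      · exact (Nat.cast_le.2 (card_firstTied_le _ hinj)).trans (hP Y hY j)
    · ext j i k
      exact (lt_iff_of_compatible (hZw j) i k).symm
  refine (Set.ncard_le_ncard hsub (Set.toFinite _)).trans
    ((Set.ncard_image_le (Set.toFinite _)).trans ?_)
  rw [Set.ncard_coe_finset, Fintype.card_piFinset]
  simp [pow_mul, sq]

theorem Finset.abs_card_inter_sub_le {ι : Type*} [DecidableEq ι] {B C B' C' : Finset ι}
    (h : B ⊆ C ∨ C ⊆ B) (h' : B' ⊆ C' ∨ C' ⊆ B') :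
    |((B ∩ B').card : ℝ) - (C ∩ C').card| ≤
      |(B.card : ℝ) - C.card| + |(B'.card : ℝ) - C'.card| := by
  have key {B C : Finset ι} (h : B ⊆ C ∨ C ⊆ B) :
      ((B \ C).card : ℝ) ≤ |(B.card : ℝ) - C.card| := by
    rcases h with h | h
    · simp [Finset.sdiff_eq_empty_iff_subset.2 h]
    · rw [Finset.cast_card_sdiff h]
      exact le_abs_self _
  have key2 {B C B' C' : Finset ι} (h : B ⊆ C ∨ C ⊆ B) (h' : B' ⊆ C' ∨ C' ⊆ B') :
      ((B ∩ B').card : ℝ) ≤ (C ∩ C').card +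
        (|(B.card : ℝ) - C.card| + |(B'.card : ℝ) - C'.card|) := by
    have h1 : B ∩ B' ⊆ (C ∩ C') ∪ ((B \ C) ∪ (B' \ C')) := by
      intro i hi
      simp only [Finset.mem_inter, Finset.mem_union, Finset.mem_sdiff] at hi ⊢
      tauto
    have h2 : (B ∩ B').card ≤ (C ∩ C').card + ((B \ C).card + (B' \ C').card) :=
      (Finset.card_le_card h1).trans ((Finset.card_union_le _ _).trans
        (Nat.add_le_add_left (Finset.card_union_le _ _) _))
    have h3 : ((B ∩ B').card : ℝ) ≤ (C ∩ C').card + ((B \ C).card + (B' \ C').card) := by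
      exact_mod_cast h2
    linarith [key h, key h']
  rw [abs_le]
  have h1 := key2 h h'
  have h2 := key2 h.symm h'.symm
  rw [abs_sub_comm (C.card : ℝ), abs_sub_comm (C'.card : ℝ)] at h2
  constructor <;> linarith

/-- Compatibility makes the rows below the threshold in `Y` and those in `Z` nested within each
column. Symmetric differences then have size equal to differences of counts, so marginal counts
control joint ones. -/
theorem abs_belowCount_sub_belowCount_le {n p : ℕ} {Y Z : Fin n → Fin p → ℝ} (hZ : Z ∈ rankSet Y)
    (t a : Fin p → ℝ) (j l : Fin p) :
    |(belowCount t Y j l : ℝ) - belowCount a Z j l| ≤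
      |(belowCount t Y j j : ℝ) - belowCount a Z j j| +
        |(belowCount t Y l l : ℝ) - belowCount a Z l l| := by
  classical
  have hnest (j : Fin p) : (Finset.univ.filter fun i => Y i j ≤ t j) ⊆
      (Finset.univ.filter fun i => Z i j ≤ a j) ∨ (Finset.univ.filter fun i => Z i j ≤ a j) ⊆
      (Finset.univ.filter fun i => Y i j ≤ t j) := by
    by_contra! h
    obtain ⟨⟨i, hi, hi'⟩, k, hk, hk'⟩ := And.imp Finset.not_subset.1 Finset.not_subset.1 h
    simp only [Finset.mem_filter, Finset.mem_univ, true_and, not_le] at hi hi' hk hk'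
    have := hZ j i k (by linarith)
    linarith
  have h := Finset.abs_card_inter_sub_le (hnest j) (hnest l)
  simpa only [belowCount, Finset.filter_and, Finset.inter_self] using h

end Patterns

/-! ### Hoeffding bounds for latent frequencies, and coincidences of independent variables. -/

section EmpiricalFrequencies

/-- Hoeffding's inequality; the sign `s = ±1` covers both tails at once. -/
theorem measureReal_pi_count_sub_ge_le {E : Type*} [MeasurableSpace E] (μ : Measure E)
    [IsProbabilityMeasure μ] {S : Set E} (hS : MeasurableSet S) {η : ℝ} (hη : 0 ≤ η) (n : ℕ)
    {s : ℝ} (hs : s ^ 2 = 1) :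
    (Measure.pi fun _ : Fin n => μ).real
      {Z | η * n ≤ s * ((∑ i, S.indicator 1 (Z i)) - n * μ.real S)} ≤
      Real.exp (-(2 * η ^ 2) * n) := by
  set P := Measure.pi fun _ : Fin n => μ
  let f : E → ℝ := fun z => s * (S.indicator 1 z - μ.real S)
  have hf : Measurable f := ((measurable_one.indicator hS).sub_const _).const_mul _
  have hind : iIndepFun (fun (i : Fin n) (Z : Fin n → E) => f (Z i)) P :=
    iIndepFun_pi fun _ => hf.aemeasurable
  have hsub (i : Fin n) : HasSubgaussianMGF (fun Z : Fin n → E => f (Z i)) (1 / 4) P := by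
    have h0 : HasSubgaussianMGF f (1 / 4) μ := by
      have h := hasSubgaussianMGF_of_mem_Icc (μ := μ) (X := S.indicator (1 : E → ℝ)) (a := 0)
        (b := 1) (measurable_one.indicator hS).aemeasurable (ae_of_all _ fun z => by
          by_cases hz : z ∈ S <;> simp [hz])
      rw [integral_indicator_one hS] at h
      have h2 := h.const_mul s
      convert h2 using 1
      refine NNReal.eq ?_
      change ((1 / 4 : NNReal) : ℝ) = s ^ 2 * (‖(1 : ℝ) - 0‖ / 2) ^ 2
      rw [hs]
      norm_num
    have hmp := measurePreserving_eval (fun _ : Fin n => μ) i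
    have h1 : HasSubgaussianMGF f (1 / 4) (P.map (Function.eval i)) := by rwa [hmp.map_eq]
    exact HasSubgaussianMGF.of_map (Y := Function.eval i) (X := f) hmp.measurable.aemeasurable h1
  have h := HasSubgaussianMGF.measure_sum_ge_le_of_iIndepFun hind (s := Finset.univ)
    (fun i _ => hsub i) (ε := η * n) (by positivity)
  have he : {Z : Fin n → E | η * n ≤ s * ((∑ i, S.indicator 1 (Z i)) - n * μ.real S)} =
      {Z | η * n ≤ ∑ i, f (Z i)} := by
    ext Z
    simp [f, ← Finset.mul_sum, Finset.sum_sub_distrib]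
  rw [he]
  refine h.trans (Real.exp_le_exp.2 ?_)
  rcases Nat.eq_zero_or_pos n with rfl | hn
  · simp
  · have : (0 : ℝ) < n := Nat.cast_pos.2 hn
    simp only [Finset.sum_const, Finset.card_univ, Fintype.card_fin]
    push_cast
    apply le_of_eq
    simp
    field_simp
    norm_num

theorem belowCount_eq_sum_indicator {n p : ℕ} (t : Fin p → ℝ) (Y : Fin n → Fin p → ℝ)
    (j l : Fin p) : (belowCount t Y j l : ℝ) =
      ∑ i, {y : Fin p → ℝ | y j ≤ t j ∧ y l ≤ t l}.indicator 1 (Y i) := by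
  simp [belowCount, Set.indicator_apply]

/-- The latent data whose empirical orthant frequencies deviate from the orthant probabilities. -/
def deviationSet {p : ℕ} (a : Fin p → ℝ) (η : ℝ) (n : ℕ) (C : CorrMatrix p) :
    Set (Fin n → Fin p → ℝ) :=
  {Z | ∃ j l, η * n ≤ |(belowCount a Z j l : ℝ) - n * orthantProb a C j l|}

theorem pi_latentLaw_deviationSet_le {p : ℕ} (a : Fin p → ℝ) {η : ℝ} (hη : 0 ≤ η) (n : ℕ)
    (C : CorrMatrix p) : Measure.pi (fun _ : Fin n => latentLaw C) (deviationSet a η n C) ≤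
      ENNReal.ofReal (2 * p ^ 2 * Real.exp (-(2 * η ^ 2) * n)) := by
  set P := Measure.pi (fun _ : Fin n => latentLaw C)
  have h1 (j l : Fin p) (s : ℝ) (hs : s ^ 2 = 1) :
      P {Z | η * n ≤ s * ((belowCount a Z j l : ℝ) - n * orthantProb a C j l)} ≤
        ENNReal.ofReal (Real.exp (-(2 * η ^ 2) * n)) := by
    rw [← ofReal_measureReal (measure_ne_top _ _)]
    refine ENNReal.ofReal_le_ofReal ?_
    simp_rw [belowCount_eq_sum_indicator]
    exact measureReal_pi_count_sub_ge_le (latentLaw C) (measurableSet_orthant a j l) hη n hs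
  have hsub : deviationSet a η n C ⊆ ⋃ j, ⋃ l,
      {Z | η * n ≤ 1 * ((belowCount a Z j l : ℝ) - n * orthantProb a C j l)} ∪
      {Z | η * n ≤ -1 * ((belowCount a Z j l : ℝ) - n * orthantProb a C j l)} := by
    rintro Z ⟨j, l, h⟩
    simp only [Set.mem_iUnion]
    refine ⟨j, l, ?_⟩
    rcases le_abs.1 h with h | h
    · left; simpa using h
    · right; simpa using h
  calc P (deviationSet a η n C) ≤ _ := measure_mono hsub
    _ ≤ ∑ j, ∑ l, _ := (measure_iUnion_fintype_le _ _).trans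
        (Finset.sum_le_sum fun j _ => measure_iUnion_fintype_le _ _)
    _ ≤ ∑ _j : Fin p, ∑ _l : Fin p, 2 * ENNReal.ofReal (Real.exp (-(2 * η ^ 2) * n)) := by
        refine Finset.sum_le_sum fun j _ => Finset.sum_le_sum fun l _ => ?_
        refine (measure_union_le _ _).trans ?_
        rw [two_mul]
        exact add_le_add (h1 j l 1 (by norm_num)) (h1 j l (-1) (by norm_num))
    _ = _ := by
        simp only [Finset.sum_const, Finset.card_univ, Fintype.card_fin, nsmul_eq_mul]
        rw [ENNReal.ofReal_mul (by positivity), ENNReal.ofReal_mul (by positivity),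
          ENNReal.ofReal_pow (by positivity)]
        simp only [ENNReal.ofReal_natCast, ENNReal.ofReal_ofNat]
        ring

theorem countable_atoms (ν : Measure ℝ) [IsProbabilityMeasure ν] : {y | ν {y} ≠ 0}.Countable := by
  have hc := Measure.countable_meas_pos_of_disjoint_iUnion (μ := ν)
    (As := fun y : ℝ => {y}) (fun y => measurableSet_singleton y)
    (fun x y hxy => by simpa [Function.onFun] using hxy)
  simpa only [pos_iff_ne_zero] using hc

/-- By Fubini, the diagonal over the non-atoms is null for the product law. This gives both the
absence of ties in latent data and the fact that observed ties occur only at atoms. -/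
theorem ae_eq_imp_atom_of_indepFun {Ω : Type*} [MeasurableSpace Ω] {P : Measure Ω}
    [IsProbabilityMeasure P] {X Y : Ω → ℝ} (hX : Measurable X) (hY : Measurable Y)
    (h : IndepFun X Y P) : ∀ᵐ ω ∂P, X ω = Y ω → P.map Y {Y ω} ≠ 0 := by
  have h1 := (indepFun_iff_map_prod_eq_prod_map_map hX.aemeasurable hY.aemeasurable).1 h
  have : IsProbabilityMeasure (P.map Y) := Measure.isProbabilityMeasure_map hY.aemeasurable
  have hatoms : MeasurableSet {y : ℝ | P.map Y {y} = 0} := by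
    have he : {y : ℝ | P.map Y {y} = 0} = {y | P.map Y {y} ≠ 0}ᶜ := by
      ext y; simp
    rw [he]
    exact (countable_atoms _).measurableSet.compl
  have hs : MeasurableSet {q : ℝ × ℝ | q.1 = q.2 ∧ P.map Y {q.2} = 0} :=
    (measurableSet_eq_fun measurable_fst measurable_snd).inter (measurable_snd hatoms)
  have hnull : ((P.map X).prod (P.map Y)) {q : ℝ × ℝ | q.1 = q.2 ∧ P.map Y {q.2} = 0} = 0 := by
    refine (Measure.measure_prod_null hs).2 (ae_of_all _ fun x => ?_)
    by_cases hx : P.map Y {x} = 0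
    · exact measure_mono_null (fun y hy => hy.1.symm) hx
    · refine measure_mono_null (t := ∅) (fun y hy => hx ?_) measure_empty
      have h1 : x = y := hy.1
      rw [h1]
      exact hy.2
  rw [← h1, Measure.map_apply (hX.prodMk hY) hs] at hnull
  filter_upwards [measure_eq_zero_iff_ae_notMem.1 hnull] with ω hω h3 h4
  exact hω ⟨h3, h4⟩

theorem latentLaw_map_eval {p : ℕ} (C : CorrMatrix p) (j : Fin p) :
    (latentLaw C).map (fun z => z j) = gaussianReal 0 1 := by
  have h := (measurePreserving_eval_multivariateGaussian (μ := 0) C.2.1 (i := j)).map_eq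
  rw [latentLaw, Measure.map_map (by fun_prop) (by fun_prop)]
  simpa [C.2.2, Function.comp_def] using h

theorem ae_pi_latentLaw_injective {p : ℕ} (n : ℕ) (C : CorrMatrix p) :
    ∀ᵐ Z ∂(Measure.pi fun _ : Fin n => latentLaw C), ∀ j, Function.Injective fun i => Z i j := by
  have h : ∀ᵐ Z ∂(Measure.pi fun _ : Fin n => latentLaw C), ∀ (j : Fin p) (i k : Fin n), i ≠ k →
      Z i j ≠ Z k j := by
    refine ae_all_iff.2 fun j => ae_all_iff.2 fun i => ae_all_iff.2 fun k => ?_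
    by_cases hik : i = k
    · simp [hik]
    · have hind : IndepFun (fun Z : Fin n → Fin p → ℝ => Z i j) (fun Z => Z k j)
          (Measure.pi fun _ : Fin n => latentLaw C) :=
        (iIndepFun_pi (X := fun (_ : Fin n) (z : Fin p → ℝ) => z j)
          (fun _ => (measurable_pi_apply j).aemeasurable)).indepFun hik
      filter_upwards [ae_eq_imp_atom_of_indepFun (by fun_prop) (by fun_prop) hind] with Z hZ _ hne
      refine hZ hne ?_
      have he : (Measure.pi fun _ : Fin n => latentLaw C).map (fun Z => Z k j) =
          gaussianReal 0 1 := by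
        have h := (measurePreserving_eval (fun _ : Fin n => latentLaw C) k).map_eq
        rw [← latentLaw_map_eval C j]
        conv_rhs => rw [← h, Measure.map_map (by fun_prop) (by fun_prop)]
        rfl
      have := nullSingletonClass_gaussianReal (μ := 0) (v := 1) one_ne_zero
      rw [he, measure_singleton]
  filter_upwards [h] with Z hZ j i k hik
  by_contra hne
  exact hZ j i k hne hik

end EmpiricalFrequencies

/-! ### Summable prior-averaged bound on the posterior mass of the far sets. -/

section PosteriorBound

/-- The probability, under `n` i.i.d. latent vectors, of being compatible with the relations `w`. -/
noncomputable def patternLikelihood {n p : ℕ} (w : Fin p → Fin n → Fin n → Prop)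
    (C : CorrMatrix p) : ℝ≥0∞ :=
  Measure.pi (fun _ : Fin n => latentLaw C) (compatibleSet w)

theorem measurable_patternLikelihood {n p : ℕ} (w : Fin p → Fin n → Fin n → Prop) :
    Measurable (patternLikelihood w) :=
  measurable_pi_latentLaw (measurableSet_compatibleSet w)

theorem patternLikelihood_le_one {n p : ℕ} (w : Fin p → Fin n → Fin n → Prop) (C : CorrMatrix p) :
    patternLikelihood w C ≤ 1 := prob_le_one

/-- The posterior under the likelihood `patternLikelihood w`. -/
noncomputable def patternPosterior {n p : ℕ} (Pr : Measure (CorrMatrix p))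
    (w : Fin p → Fin n → Fin n → Prop) : Measure (CorrMatrix p) :=
  (∫⁻ C, patternLikelihood w C ∂Pr)⁻¹ • Pr.withDensity (patternLikelihood w)

theorem rankPosterior_eq_patternPosterior {n p : ℕ} (Pr : Measure (CorrMatrix p))
    (Y : Fin n → Fin p → ℝ) : rankPosterior Pr Y = patternPosterior Pr (strictPattern Y) := rfl

/-- The correlation matrices whose orthant probabilities are far from the frequencies below `t`
in some typical data set with pattern `w`. -/
def farSet {n p : ℕ} (t g a : Fin p → ℝ) (κ η : ℝ) (w : Fin p → Fin n → Fin n → Prop) :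
    Set (CorrMatrix p) :=
  {C | ∃ j l, ∃ m : ℕ, (∃ Y : Fin n → Fin p → ℝ, IsTypical t g κ η Y ∧ strictPattern Y = w ∧
    belowCount t Y j l = m) ∧ 5 * η * n < |(m : ℝ) - n * orthantProb a C j l|}

theorem measurableSet_farSet {n p : ℕ} (t g a : Fin p → ℝ) (κ η : ℝ)
    (w : Fin p → Fin n → Fin n → Prop) : MeasurableSet (farSet t g a κ η w) := by
  simp only [farSet, Set.ofPred_exists]
  refine MeasurableSet.iUnion fun j => MeasurableSet.iUnion fun l => MeasurableSet.iUnion fun m =>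
    MeasurableSet.inter (MeasurableSet.const _) ?_
  have h : Measurable fun C : CorrMatrix p => |(m : ℝ) - n * orthantProb a C j l| :=
    measurable_abs.comp (((measurable_orthantProb a j l).const_mul _).const_sub _)
  exact measurableSet_lt measurable_const h

/-- The `5η` splits as `2η + 2η` for passing from the counts of `Y` to those of `Z`, one `2η` per
coordinate, and `η` for the deviation of `Z`. The marginal comparison is possible because the
one-dimensional probabilities `g j` do not depend on `C`. -/
theorem mem_deviationSet_of_mem_farSet {n p : ℕ} {t g a : Fin p → ℝ} {κ η : ℝ}
    (hg : ∀ C j, orthantProb a C j j = g j) {w : Fin p → Fin n → Fin n → Prop}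
    {C : CorrMatrix p} (hC : C ∈ farSet t g a κ η w) {Z : Fin n → Fin p → ℝ}
    (hZ : Z ∈ compatibleSet w) : Z ∈ deviationSet a η n C := by
  obtain ⟨j, l, m, ⟨Y, hY, rfl, rfl⟩, hfar⟩ := hC
  by_contra hdev
  simp only [deviationSet, Set.mem_ofPred_eq, not_exists, not_le] at hdev
  have h0 := abs_belowCount_sub_belowCount_le (Y := Y) hZ t a j l
  have h1 (j : Fin p) : |(belowCount t Y j j : ℝ) - belowCount a Z j j| ≤ 2 * (η * n) := by
    have h2 := hY.abs_belowCount_sub_le j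
    have h3 := hdev j j
    rw [hg, abs_sub_comm] at h3
    have := abs_sub_le (belowCount t Y j j : ℝ) (n * g j) (belowCount a Z j j)
    linarith
  have h2 := hdev j l
  have := abs_sub_le (belowCount t Y j l : ℝ) (belowCount a Z j l) (n * orthantProb a C j l)
  linarith [h1 j, h1 l]

-- Writing each likelihood as an integral over `Z` exchanges the sum over patterns with a count of
-- the typical patterns compatible with `Z`. That count is small, and it matters only on the
-- deviation set.
open scoped Classical in
theorem sum_indicator_farSet_le {n p : ℕ} {t g a : Fin p → ℝ} {κ η : ℝ}
    (hg : ∀ C j, orthantProb a C j j = g j) (C : CorrMatrix p) :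
    ∑ w : Fin p → Fin n → Fin n → Prop, (farSet t g a κ η w).indicator (patternLikelihood w) C ≤
      ((Finset.univ.filter fun A : Finset (Fin n) => (A.card : ℝ) ≤ κ * n).card ^ (2 * p) : ℕ) *
        Measure.pi (fun _ : Fin n => latentLaw C) (deviationSet a η n C) := by
  set N := (Finset.univ.filter fun A : Finset (Fin n) => (A.card : ℝ) ≤ κ * n).card ^ (2 * p)
  set P := Measure.pi (fun _ : Fin n => latentLaw C)
  have hterm (w : Fin p → Fin n → Fin n → Prop) :
      (farSet t g a κ η w).indicator (patternLikelihood w) C =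
        ∫⁻ Z, (compatibleSet w).indicator (fun _ => (farSet t g a κ η w).indicator 1 C) Z ∂P := by
    rw [lintegral_indicator_const (measurableSet_compatibleSet w)]
    by_cases h : C ∈ farSet t g a κ η w <;> simp [h, P, patternLikelihood]
  simp_rw [hterm]
  rw [← lintegral_finsetSum _ fun w _ => measurable_const.indicator (measurableSet_compatibleSet w)]
  refine le_trans (lintegral_mono_ae ?_) (lintegral_indicator_const_le _ _)
  filter_upwards [ae_pi_latentLaw_injective n C] with Z hZ
  by_cases hdev : Z ∈ deviationSet a η n C
  · rw [Set.indicator_of_mem hdev]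
    have hcount := ncard_strictPattern_compatible_le hZ (IsTypical t g κ η)
      fun Y hY => hY.card_tiedValues_le
    calc ∑ w, (compatibleSet w).indicator (fun _ => (farSet t g a κ η w).indicator 1 C) Z
        ≤ ∑ w, if Z ∈ compatibleSet w ∧ ∃ Y, IsTypical t g κ η Y ∧ strictPattern Y = w
            then (1 : ℝ≥0∞) else 0 := by
          refine Finset.sum_le_sum fun w _ => ?_
          by_cases h1 : Z ∈ compatibleSet w <;> by_cases h2 : C ∈ farSet t g a κ η w
          · obtain ⟨j, l, m, ⟨Y, hY, hYw, -⟩, -⟩ := id h2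
            have : Z ∈ compatibleSet w ∧ ∃ Y, IsTypical t g κ η Y ∧ strictPattern Y = w :=
              ⟨h1, Y, hY, hYw⟩
            simp [h1, h2, this]
          all_goals simp [h1, h2]
      _ = (({w | Z ∈ compatibleSet w ∧ ∃ Y, IsTypical t g κ η Y ∧ strictPattern Y = w}.ncard : ℕ)
            : ℝ≥0∞) := by
          rw [Finset.sum_boole, ← Set.ncard_coe_finset]
          congr 2
          ext w
          simp
      _ ≤ N := by exact_mod_cast hcount
  · rw [Set.indicator_of_notMem hdev]
    refine (Finset.sum_eq_zero fun w _ => ?_).le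
    by_cases h1 : Z ∈ compatibleSet w
    · have h2 : C ∉ farSet t g a κ η w := fun h =>
        hdev (mem_deviationSet_of_mem_farSet hg h h1)
      simp [h2]
    · simp [h1]

/-- Averaging the likelihood over the prior produces the evidence, which cancels the normalization
of the posterior and leaves the likelihood integrated over the far set. -/
theorem lintegral_patternPosterior_farSet_le {n p : ℕ} (Pr : Measure (CorrMatrix p))
    [IsProbabilityMeasure Pr] {t g a : Fin p → ℝ} {κ η : ℝ} (hη : 0 ≤ η)
    (hg : ∀ C j, orthantProb a C j j = g j) :
    ∫⁻ C, ∑ w : Fin p → Fin n → Fin n → Prop,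
        patternLikelihood w C * patternPosterior Pr w (farSet t g a κ η w) ∂Pr ≤
      ((Finset.univ.filter fun A : Finset (Fin n) => (A.card : ℝ) ≤ κ * n).card ^ (2 * p) : ℕ) *
        ENNReal.ofReal (2 * p ^ 2 * Real.exp (-(2 * η ^ 2) * n)) := by
  rw [lintegral_finsetSum _ fun w _ => (measurable_patternLikelihood w).mul_const _]
  calc _ ≤ ∑ w : Fin p → Fin n → Fin n → Prop,
        ∫⁻ C, (farSet t g a κ η w).indicator (patternLikelihood w) C ∂Pr := by
        refine Finset.sum_le_sum fun w _ => ?_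
        rw [lintegral_mul_const _ (measurable_patternLikelihood w), patternPosterior,
          Measure.smul_apply, withDensity_apply _ (measurableSet_farSet t g a κ η w),
          smul_eq_mul, ← mul_assoc, lintegral_indicator (measurableSet_farSet t g a κ η w)]
        -- An inequality is enough here, and it also covers patterns of zero evidence.
        exact mul_le_of_le_one_left' (ENNReal.mul_inv_le_one _)
    _ = ∫⁻ C, ∑ w : Fin p → Fin n → Fin n → Prop,
        (farSet t g a κ η w).indicator (patternLikelihood w) C ∂Pr :=
        (lintegral_finsetSum _ fun w _ =>
          (measurable_patternLikelihood w).indicator (measurableSet_farSet t g a κ η w)).symm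
    _ ≤ ∫⁻ _C, _ ∂Pr := lintegral_mono fun C => (sum_indicator_farSet_le hg C).trans
        (mul_le_mul_right (pi_latentLaw_deviationSet_le a hη n C) _)
    _ = _ := by simp

theorem exists_ae_tsum_patternPosterior_farSet_ne_top {p : ℕ} (Pr : Measure (CorrMatrix p))
    [IsProbabilityMeasure Pr] {t g a : Fin p → ℝ} {η : ℝ} (hη : 0 < η)
    (hg : ∀ C j, orthantProb a C j j = g j) :
    ∃ κ > 0, ∀ᵐ C ∂Pr, ∑' n : ℕ, ∑ w : Fin p → Fin n → Fin n → Prop,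
      patternLikelihood w C * patternPosterior Pr w (farSet t g a κ η w) ≠ ∞ := by
  -- With this rate the overcount, raised to the power `2p`, is at most `exp (η²n)`, half of the
  -- Hoeffding exponent; the `+ 1` avoids division by zero at `p = 0`.
  have hδ : 0 < η ^ 2 / (2 * p + 1) := by positivity
  obtain ⟨κ, hκ, hN⟩ := exists_forall_card_filter_card_le_exp hδ
  refine ⟨κ, hκ, ?_⟩
  have hm (n : ℕ) : Measurable fun C => ∑ w : Fin p → Fin n → Fin n → Prop,
      patternLikelihood w C * patternPosterior Pr w (farSet t g a κ η w) :=
    Finset.measurable_sum _ fun w _ => (measurable_patternLikelihood w).mul_const _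
  have hbound (n : ℕ) : ∫⁻ C, ∑ w : Fin p → Fin n → Fin n → Prop,
      patternLikelihood w C * patternPosterior Pr w (farSet t g a κ η w) ∂Pr ≤
      ENNReal.ofReal (2 * p ^ 2 * Real.exp (n * -η ^ 2)) := by
    refine (lintegral_patternPosterior_farSet_le Pr hη.le hg).trans ?_
    rw [← ENNReal.ofReal_natCast, ← ENNReal.ofReal_mul (by positivity)]
    refine ENNReal.ofReal_le_ofReal ?_
    push_cast
    calc _ ≤ (Real.exp (η ^ 2 / (2 * p + 1) * n)) ^ (2 * p) *
          (2 * p ^ 2 * Real.exp (-(2 * η ^ 2) * n)) := by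
          gcongr
          exact hN n
      _ = 2 * p ^ 2 * Real.exp ((2 * p) * (η ^ 2 / (2 * p + 1) * n) + -(2 * η ^ 2) * n) := by
          rw [← Real.exp_nat_mul, Real.exp_add]
          push_cast
          ring
      _ ≤ _ := by
          gcongr
          have h1 : 2 * (p : ℝ) * (η ^ 2 / (2 * p + 1)) ≤ η ^ 2 := by
            rw [mul_div_assoc', div_le_iff₀ (by positivity)]
            nlinarith [sq_nonneg η]
          have h2 : (0 : ℝ) ≤ n := Nat.cast_nonneg n
          nlinarith
  have hfin : ∫⁻ C, ∑' n : ℕ, ∑ w : Fin p → Fin n → Fin n → Prop,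
      patternLikelihood w C * patternPosterior Pr w (farSet t g a κ η w) ∂Pr ≠ ∞ := by
    rw [lintegral_tsum fun n => (hm n).aemeasurable]
    refine ne_top_of_le_ne_top ?_ (ENNReal.tsum_le_tsum hbound)
    have hs : Summable fun n : ℕ => 2 * (p : ℝ) ^ 2 * Real.exp (n * -η ^ 2) :=
      (Real.summable_exp_nat_mul_iff.2 (by nlinarith)).mul_left _
    rw [← ENNReal.ofReal_tsum_of_nonneg (fun n => by positivity) hs]
    exact ENNReal.ofReal_ne_top
  filter_upwards [ae_lt_top (Measurable.tsum hm) hfin] with C hC using hC.ne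

end PosteriorBound

/-! ### Copula observations: thresholds, patterns, frequencies and ties. -/

section Observations

theorem pseudoInverse_le_iff {F : StieltjesFunction ℝ} (h0 : Tendsto F atBot (𝓝 0))
    (h1 : Tendsto F atTop (𝓝 1)) {u : ℝ} (hu : u ∈ Set.Ioo (0 : ℝ) 1) (t : ℝ) :
    pseudoInverse F u ≤ t ↔ u ≤ F t := by
  have hbdd : BddBelow {y : ℝ | u ≤ F y} := by
    obtain ⟨y, hy⟩ := (h0.eventually_lt_const hu.1).exists
    refine ⟨y, fun w hw => ?_⟩
    by_contra! hc
    exact absurd (hy.trans_le hw) (not_lt.2 (F.mono hc.le))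
  have hne : {y : ℝ | u ≤ F y}.Nonempty := by
    obtain ⟨y, hy⟩ := (h1.eventually_const_lt hu.2).exists
    exact ⟨y, hy.le⟩
  refine ⟨fun h => ?_, fun h => csInf_le hbdd h⟩
  have hright : Tendsto F (𝓝[>] t) (𝓝 (F t)) :=
    (F.right_continuous t).tendsto.mono_left (nhdsWithin_mono _ Set.Ioi_subset_Ici_self)
  refine ge_of_tendsto hright ?_
  filter_upwards [self_mem_nhdsWithin] with y hy
  obtain ⟨w, hw, hwy⟩ := exists_lt_of_csInf_lt hne (h.trans_lt hy)
  exact le_trans hw (F.mono hwy.le)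

theorem pseudoInverse_stdNormalCDF_mono {F : StieltjesFunction ℝ} (h0 : Tendsto F atBot (𝓝 0))
    (h1 : Tendsto F atTop (𝓝 1)) : Monotone fun x => pseudoInverse F (stdNormalCDF x) := by
  intro x y hxy
  refine (pseudoInverse_le_iff h0 h1 (stdNormalCDF_mem_Ioo x) _).2 ?_
  exact le_trans (monotone_cdf _ hxy)
    ((pseudoInverse_le_iff h0 h1 (stdNormalCDF_mem_Ioo y) _).1 le_rfl)

theorem continuous_stdNormalCDF : Continuous stdNormalCDF := by
  have := nullSingletonClass_gaussianReal (μ := 0) (v := 1) one_ne_zero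
  refine continuous_iff_continuousAt.2 fun x => ?_
  have h := (cdf (gaussianReal 0 1)).measure_singleton x
  rw [measure_cdf, measure_singleton] at h
  have h2 : Function.leftLim (cdf (gaussianReal 0 1)) x = cdf (gaussianReal 0 1) x :=
    le_antisymm ((monotone_cdf _).leftLim_le le_rfl) (by
      linarith [ENNReal.ofReal_eq_zero.1 h.symm])
  refine (monotone_cdf (gaussianReal 0 1)).continuousAt_iff_leftLim_eq_rightLim.2 ?_
  rw [h2, StieltjesFunction.rightLim_eq]

theorem exists_stdNormalCDF_le_iff {c : ℝ} (hc : c ∈ Set.Ioo (0 : ℝ) 1) :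
    ∃ a, ∀ z, stdNormalCDF z ≤ c ↔ z ≤ a := by
  have hne : {z | stdNormalCDF z ≤ c}.Nonempty := by
    obtain ⟨y, hy⟩ := ((tendsto_cdf_atBot (gaussianReal 0 1)).eventually_lt_const hc.1).exists
    exact ⟨y, hy.le⟩
  have hbdd : BddAbove {z | stdNormalCDF z ≤ c} := by
    obtain ⟨y, hy⟩ := ((tendsto_cdf_atTop (gaussianReal 0 1)).eventually_const_lt hc.2).exists
    refine ⟨y, fun w hw => ?_⟩
    by_contra! hlt
    exact absurd (hy.trans_le ((monotone_cdf _) hlt.le)) (not_lt.2 hw)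
  have hcl : IsClosed {z | stdNormalCDF z ≤ c} :=
    isClosed_le continuous_stdNormalCDF continuous_const
  exact ⟨sSup {z | stdNormalCDF z ≤ c}, fun z => ⟨fun hz => le_csSup hbdd hz,
    fun hz => le_trans (monotone_cdf _ hz) (hcl.csSup_mem hne hbdd)⟩⟩

theorem orthantProb_self {p : ℕ} (a : Fin p → ℝ) (C : CorrMatrix p) (j : Fin p) :
    orthantProb a C j j = (gaussianReal 0 1).real (Set.Iic (a j)) := by
  rw [← latentLaw_map_eval C j, map_measureReal_apply (by fun_prop) measurableSet_Iic]
  simp [orthantProb, Set.preimage, Set.Iic]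

/-- The Galois property of the pseudo-inverse turns `F⁻¹(Φ(z)) ≤ t` into `Φ(z) ≤ F(t)`, that is, `z
≤ a`. -/
theorem copulaLaw_real_orthant {p : ℕ} {F : Fin p → StieltjesFunction ℝ}
    (h0 : ∀ j, Tendsto (F j) atBot (𝓝 0)) (h1 : ∀ j, Tendsto (F j) atTop (𝓝 1))
    {t a : Fin p → ℝ} (ha : ∀ j z, stdNormalCDF z ≤ F j (t j) ↔ z ≤ a j) (C : CorrMatrix p)
    (j l : Fin p) :
    (copulaLaw C F).real {y | y j ≤ t j ∧ y l ≤ t l} = orthantProb a C j l := by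
  rw [copulaLaw, map_measureReal_apply (measurable_observe F h0 h1) (measurableSet_orthant t j l),
    orthantProb]
  congr 1
  ext z
  simp only [Set.mem_preimage, Set.mem_ofPred_eq, observe,
    pseudoInverse_le_iff (h0 _) (h1 _) (stdNormalCDF_mem_Ioo _), ha]

theorem mem_rankSet_observe {n p : ℕ} {F : Fin p → StieltjesFunction ℝ}
    (h0 : ∀ j, Tendsto (F j) atBot (𝓝 0)) (h1 : ∀ j, Tendsto (F j) atTop (𝓝 1))
    (Z : Fin n → Fin p → ℝ) : Z ∈ rankSet fun i => observe F (Z i) := by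
  intro j i k hik
  by_contra! hc
  exact absurd (pseudoInverse_stdNormalCDF_mono (h0 j) (h1 j) hc) (not_le.2 hik)

theorem infinitePi_map_fin {E : Type*} [MeasurableSpace E] (μ : Measure E) [IsProbabilityMeasure μ]
    (n : ℕ) : (Measure.infinitePi fun _ : ℕ => μ).map (fun Y (i : Fin n) => Y i) =
      Measure.pi fun _ : Fin n => μ := by
  have h := (iIndepFun_infinitePi (P := fun _ : ℕ => μ) (X := fun _ y => y)
    fun _ => measurable_id).precomp (Fin.val_injective (n := n))
  rw [iIndepFun_iff_map_fun_eq_pi_map fun i : Fin n =>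
    (measurable_pi_apply (X := fun _ : ℕ => E) (i : ℕ)).aemeasurable] at h
  rw [h]
  congr 1
  ext1 i
  exact Measure.infinitePi_map_eval (fun _ : ℕ => μ) i

/-- The latent vectors generating the data always lie in the rank set of the data. The converse can
fail with ties, so only an inequality holds. -/
theorem dataLaw_strictPattern_le {p : ℕ} {F : Fin p → StieltjesFunction ℝ}
    (h0 : ∀ j, Tendsto (F j) atBot (𝓝 0)) (h1 : ∀ j, Tendsto (F j) atTop (𝓝 1))
    (C : CorrMatrix p) {n : ℕ} (w : Fin p → Fin n → Fin n → Prop) :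
    dataLaw C F {Y | strictPattern (fun i : Fin n => Y i) = w} ≤ patternLikelihood w C := by
  have := isProbabilityMeasure_copulaLaw C F h0 h1
  have hobs := measurable_observe F h0 h1
  have hm : Measurable fun (Y : ℕ → Fin p → ℝ) (i : Fin n) => Y i := by fun_prop
  have hS := measurableSet_strictPattern_eq w
  calc dataLaw C F {Y | strictPattern (fun i : Fin n => Y i) = w}
      = (dataLaw C F).map (fun Y (i : Fin n) => Y i) {Y | strictPattern Y = w} := by
        rw [Measure.map_apply hm hS]; rfl
    _ = Measure.pi (fun _ : Fin n => latentLaw C)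
          {Z | strictPattern (fun i => observe F (Z i)) = w} := by
        rw [dataLaw, infinitePi_map_fin]
        simp only [copulaLaw]
        rw [← Measure.pi_map_pi (fun _ => hobs.aemeasurable),
          Measure.map_apply (by fun_prop) hS]
        rfl
    _ ≤ patternLikelihood w C := measure_mono fun Z hZ => by
        have h : strictPattern (fun i => observe F (Z i)) = w := hZ
        rw [← h]
        exact mem_rankSet_observe h0 h1 Z

theorem ae_tendsto_frequency {E : Type*} [MeasurableSpace E] (μ : Measure E)
    [IsProbabilityMeasure μ] {S : Set E} (hS : MeasurableSet S) :
    ∀ᵐ Y ∂(Measure.infinitePi fun _ : ℕ => μ), Tendsto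
      (fun n : ℕ => (∑ i : Fin n, S.indicator (1 : E → ℝ) (Y i)) / n) atTop (𝓝 (μ.real S)) := by
  have hf : Measurable (S.indicator (1 : E → ℝ)) := measurable_one.indicator hS
  have hmp (i : ℕ) := measurePreserving_eval_infinitePi (fun _ : ℕ => μ) i
  have hint : Integrable (S.indicator (1 : E → ℝ)) μ := (integrable_const 1).indicator hS
  have h := strong_law_ae_real (μ := Measure.infinitePi fun _ : ℕ => μ)
    (fun i Y => S.indicator (1 : E → ℝ) (Y i))
    ((hmp 0).integrable_comp_of_integrable hint)
    (fun i k hik => (iIndepFun_infinitePi (P := fun _ : ℕ => μ)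
      (X := fun _ => S.indicator (1 : E → ℝ)) fun _ => hf).indepFun hik)
    (fun i => ⟨(hf.comp (measurable_pi_apply i)).aemeasurable,
      (hf.comp (measurable_pi_apply 0)).aemeasurable, by
        have (i : ℕ) : (Measure.infinitePi fun _ : ℕ => μ).map
            (fun Y => S.indicator (1 : E → ℝ) (Y i)) = μ.map (S.indicator 1) := by
          conv_rhs => rw [← (hmp i).map_eq, Measure.map_map hf (measurable_pi_apply i)]
          rfl
        rw [this, this]⟩)
  have hmean : ∫ Y, S.indicator (1 : E → ℝ) (Y 0) ∂(Measure.infinitePi fun _ : ℕ => μ) =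
      μ.real S := by
    rw [← integral_indicator_one hS]
    conv_rhs => rw [← (hmp 0).map_eq]
    rw [integral_map (measurable_pi_apply 0).aemeasurable hf.aestronglyMeasurable]
  rw [hmean] at h
  filter_upwards [h] with Y hY
  simpa only [Finset.sum_range] using hY

theorem exists_finset_measureReal_atoms_diff_lt (ν : Measure ℝ) [IsProbabilityMeasure ν] {κ : ℝ}
    (hκ : 0 < κ) : ∃ V : Finset ℝ, ν.real ({y | ν {y} ≠ 0} \ V) < κ := by
  have hc := countable_atoms ν
  have hsum : ∑' y : {y | ν {y} ≠ 0}, ν {y.1} ≠ ∞ := by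
    have := hc.to_subtype
    rw [← measure_biUnion hc (f := fun y => {y}) (fun x _ y _ hxy => by
      simpa [Function.onFun] using hxy) (fun y _ => measurableSet_singleton y)]
    exact measure_ne_top _ _
  have htend := ENNReal.tendsto_tsum_compl_atTop_zero hsum
  obtain ⟨V, hV⟩ := (htend.eventually_lt_const (ENNReal.ofReal_pos.2 hκ)).exists
  refine ⟨V.map (Function.Embedding.subtype _), ?_⟩
  have hle : ν ({y | ν {y} ≠ 0} \ (V.map (Function.Embedding.subtype _) : Finset ℝ)) ≤
      ∑' y : {y // y ∉ V}, ν {y.1.1} := by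
    have := hc.to_subtype
    refine le_trans (measure_mono fun y hy => ?_)
      (measure_iUnion_le fun y : {y // y ∉ V} => {y.1.1})
    refine Set.mem_iUnion.2 ⟨⟨⟨y, hy.1⟩, fun hyV => hy.2 ?_⟩, rfl⟩
    simp only [Finset.coe_map, Set.mem_image]
    exact ⟨⟨y, hy.1⟩, hyV, rfl⟩
  exact (ENNReal.toReal_lt_toReal (measure_ne_top _ _) ENNReal.ofReal_ne_top).2 (hle.trans_lt hV)
    |>.trans_eq (ENNReal.toReal_ofReal hκ.le)

/-- Tied values are almost surely atoms. All but finitely many atoms carry total mass below `κ/2`,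
so the exceptional ones are hit by fewer than `κn/2` observations eventually; the finite remainder
is at most `κn/2` for large `n`. -/
theorem ae_eventually_card_tiedValues_le {p : ℕ} (μ : Measure (Fin p → ℝ)) [IsProbabilityMeasure μ]
    {κ : ℝ} (hκ : 0 < κ) (j : Fin p) : ∀ᵐ Y ∂(Measure.infinitePi fun _ : ℕ => μ),
      ∀ᶠ n : ℕ in atTop, ((tiedValues fun i : Fin n => Y i j).card : ℝ) ≤ κ * n := by
  classical
  set ν := μ.map fun y => y j
  have : IsProbabilityMeasure ν := Measure.isProbabilityMeasure_map
    (measurable_pi_apply j).aemeasurable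
  obtain ⟨V, hV⟩ := exists_finset_measureReal_atoms_diff_lt ν (half_pos hκ)
  set R := {y | ν {y} ≠ 0} \ (V : Set ℝ)
  have hR : MeasurableSet R := (countable_atoms ν).measurableSet.diff V.measurableSet
  set S : Set (Fin p → ℝ) := (fun y => y j) ⁻¹' R
  have hS : MeasurableSet S := measurable_pi_apply j hR
  have hμS : μ.real S < κ / 2 := by
    rwa [map_measureReal_apply (by fun_prop) hR] at hV
  have htie : ∀ᵐ Y ∂(Measure.infinitePi fun _ : ℕ => μ), ∀ i k : ℕ, i ≠ k → Y i j = Y k j →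
      ν {Y k j} ≠ 0 := by
    refine ae_all_iff.2 fun i => ae_all_iff.2 fun k => ?_
    by_cases hik : i = k
    · simp [hik]
    · have hind : IndepFun (fun Y : ℕ → Fin p → ℝ => Y i j) (fun Y => Y k j)
          (Measure.infinitePi fun _ : ℕ => μ) :=
        (iIndepFun_infinitePi (P := fun _ : ℕ => μ) (X := fun _ (y : Fin p → ℝ) => y j)
          fun _ => measurable_pi_apply j).indepFun hik
      have he : (Measure.infinitePi fun _ : ℕ => μ).map (fun Y => Y k j) = ν := by
        have h := (measurePreserving_eval_infinitePi (fun _ : ℕ => μ) k).map_eq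
        conv_rhs => rw [show ν = μ.map fun y => y j from rfl, ← h,
          Measure.map_map (by fun_prop) (by fun_prop)]
        rfl
      filter_upwards [ae_eq_imp_atom_of_indepFun (by fun_prop) (by fun_prop) hind] with Y hY _
      rwa [he] at hY
  filter_upwards [ae_tendsto_frequency μ hS, htie] with Y hfreq hY
  have hVn : ∀ᶠ n : ℕ in atTop, (V.card : ℝ) / (κ / 2) ≤ n :=
    tendsto_natCast_atTop_atTop.eventually_ge_atTop _
  filter_upwards [hfreq.eventually_lt_const hμS, hVn, eventually_gt_atTop 0] with n h1 h2 h3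
  have hn : (0 : ℝ) < n := Nat.cast_pos.2 h3
  rw [div_lt_iff₀ hn] at h1
  rw [div_le_iff₀ (half_pos hκ)] at h2
  have hsub : tiedValues (fun i : Fin n => Y i j) ⊆
      V ∪ (Finset.univ.filter fun i : Fin n => Y i ∈ S).image fun i : Fin n => Y i j := by
    intro v hv
    simp only [tiedValues, Finset.mem_image, Finset.mem_filter, Finset.mem_univ, true_and] at hv
    obtain ⟨i, ⟨k, hki, hk⟩, rfl⟩ := hv
    have hatom := hY k i (fun h => hki (Fin.ext h)) hk
    by_cases hV : Y i j ∈ V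
    · exact Finset.mem_union_left _ hV
    · refine Finset.mem_union_right _ (Finset.mem_image_of_mem _
        (Finset.mem_filter.2 ⟨Finset.mem_univ _, ?_⟩))
      exact (⟨hatom, hV⟩ : Y i j ∈ R)
  have hcard : ((tiedValues fun i : Fin n => Y i j).card : ℝ) ≤
      V.card + (Finset.univ.filter fun i : Fin n => Y i ∈ S).card := by
    exact_mod_cast (Finset.card_le_card hsub).trans ((Finset.card_union_le _ _).trans
      (Nat.add_le_add_left Finset.card_image_le _))
  have hsum : ∑ i : Fin n, S.indicator (1 : (Fin p → ℝ) → ℝ) (Y i) =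
      (Finset.univ.filter fun i : Fin n => Y i ∈ S).card := by
    simp [Set.indicator_apply]
  rw [hsum] at h1
  linarith

theorem ae_eventually_abs_belowCount_sub_le {p : ℕ} {F : Fin p → StieltjesFunction ℝ}
    (h0 : ∀ j, Tendsto (F j) atBot (𝓝 0)) (h1 : ∀ j, Tendsto (F j) atTop (𝓝 1))
    {t a : Fin p → ℝ} (ha : ∀ j z, stdNormalCDF z ≤ F j (t j) ↔ z ≤ a j) (C : CorrMatrix p)
    {η : ℝ} (hη : 0 < η) : ∀ᵐ Y ∂(dataLaw C F), ∀ᶠ n : ℕ in atTop, ∀ j l,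
      |(belowCount t (fun i : Fin n => Y i) j l : ℝ) - n * orthantProb a C j l| ≤ η * n := by
  have := isProbabilityMeasure_copulaLaw C F h0 h1
  have h (j l : Fin p) := ae_tendsto_frequency (copulaLaw C F) (measurableSet_orthant t j l)
  filter_upwards [ae_all_iff.2 fun j => ae_all_iff.2 (h j)] with Y hY
  refine eventually_all.2 fun j => eventually_all.2 fun l => ?_
  have h2 := hY j l
  rw [copulaLaw_real_orthant h0 h1 ha] at h2
  filter_upwards [h2.eventually (Metric.ball_mem_nhds _ hη), eventually_gt_atTop 0] with n h3 h4
  have hn : (0 : ℝ) < n := Nat.cast_pos.2 h4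
  rw [Real.dist_eq, ← belowCount_eq_sum_indicator t fun i : Fin n => Y i] at h3
  have h5 : (belowCount t (fun i : Fin n => Y i) j l : ℝ) - n * orthantProb a C j l =
      n * ((belowCount t (fun i : Fin n => Y i) j l : ℝ) / n - orthantProb a C j l) := by
    field_simp
  rw [h5, abs_mul, abs_of_pos hn, mul_comm]
  exact mul_le_mul_of_nonneg_right h3.le hn.le

end Observations

/-! ### From summability to almost sure consistency. -/

section Consistency

theorem measurable_strictPattern_comp {p n : ℕ} (f : (Fin p → Fin n → Fin n → Prop) → ℝ≥0∞) :
    Measurable fun Y : ℕ → Fin p → ℝ => f (strictPattern fun i : Fin n => Y i) := by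
  have h : Measurable fun Y : Fin n → Fin p → ℝ => f (strictPattern Y) := by
    intro s _
    have : (fun Y : Fin n → Fin p → ℝ => f (strictPattern Y)) ⁻¹' s =
        ⋃ w ∈ f ⁻¹' s, {Y | strictPattern Y = w} := by
      ext Y; simp
    rw [this]
    exact MeasurableSet.biUnion (Set.to_countable _) fun w _ => measurableSet_strictPattern_eq w
  exact h.comp (g := fun Y => f (strictPattern Y))
    (f := fun (Y : ℕ → Fin p → ℝ) (i : Fin n) => Y i) (by fun_prop)

theorem lintegral_strictPattern_le {p : ℕ} {F : Fin p → StieltjesFunction ℝ}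
    (h0 : ∀ j, Tendsto (F j) atBot (𝓝 0)) (h1 : ∀ j, Tendsto (F j) atTop (𝓝 1))
    (C : CorrMatrix p) {n : ℕ} (f : (Fin p → Fin n → Fin n → Prop) → ℝ≥0∞) :
    ∫⁻ Y, f (strictPattern fun i : Fin n => Y i) ∂(dataLaw C F) ≤
      ∑ w, patternLikelihood w C * f w := by
  classical
  have hm (w : Fin p → Fin n → Fin n → Prop) :
      MeasurableSet {Y : ℕ → Fin p → ℝ | strictPattern (fun i : Fin n => Y i) = w} :=
    (show Measurable fun (Y : ℕ → Fin p → ℝ) (i : Fin n) => Y i by fun_prop)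
      (measurableSet_strictPattern_eq w)
  have h (Y : ℕ → Fin p → ℝ) : f (strictPattern fun i : Fin n => Y i) =
      ∑ w, {Y : ℕ → Fin p → ℝ | strictPattern (fun i : Fin n => Y i) = w}.indicator
        (fun _ => f w) Y := by
    simp [Set.indicator_apply]
  simp_rw [h]
  rw [lintegral_finsetSum _ fun w _ => measurable_const.indicator (hm w)]
  refine Finset.sum_le_sum fun w _ => ?_
  rw [lintegral_indicator_const (hm w), mul_comm]
  exact mul_le_mul_left (dataLaw_strictPattern_le h0 h1 C w) _

/-- The likelihood-weighted sum dominates the expected posterior mass under the data law. A series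
of nonnegative variables with finite expectation converges almost surely, so its terms vanish. -/
theorem ae_tendsto_patternPosterior_farSet {p : ℕ} {F : Fin p → StieltjesFunction ℝ}
    (h0 : ∀ j, Tendsto (F j) atBot (𝓝 0)) (h1 : ∀ j, Tendsto (F j) atTop (𝓝 1))
    (Pr : Measure (CorrMatrix p)) {t g a : Fin p → ℝ} {κ η : ℝ} {C₀ : CorrMatrix p}
    (hsum : ∑' n : ℕ, ∑ w : Fin p → Fin n → Fin n → Prop,
      patternLikelihood w C₀ * patternPosterior Pr w (farSet t g a κ η w) ≠ ∞) :
    ∀ᵐ Y ∂(dataLaw C₀ F), Tendsto (fun n : ℕ =>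
      patternPosterior Pr (strictPattern fun i : Fin n => Y i)
        (farSet t g a κ η (strictPattern fun i : Fin n => Y i))) atTop (𝓝 0) := by
  have hm (n : ℕ) : Measurable fun Y : ℕ → Fin p → ℝ =>
      patternPosterior Pr (strictPattern fun i : Fin n => Y i)
        (farSet t g a κ η (strictPattern fun i : Fin n => Y i)) :=
    measurable_strictPattern_comp fun w => patternPosterior Pr w (farSet t g a κ η w)
  have hfin : ∫⁻ Y, ∑' n : ℕ, patternPosterior Pr (strictPattern fun i : Fin n => Y i)
        (farSet t g a κ η (strictPattern fun i : Fin n => Y i)) ∂(dataLaw C₀ F) ≠ ∞ := by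
    rw [lintegral_tsum fun n => (hm n).aemeasurable]
    exact ne_top_of_le_ne_top hsum (ENNReal.tsum_le_tsum fun n =>
      lintegral_strictPattern_le h0 h1 C₀ fun w => patternPosterior Pr w (farSet t g a κ η w))
  filter_upwards [ae_lt_top (Measurable.tsum hm) hfin] with Y hY
  exact ENNReal.tendsto_atTop_zero_of_tsum_ne_top hY.ne

theorem ae_patternLikelihood_ne_zero {p : ℕ} {F : Fin p → StieltjesFunction ℝ}
    (h0 : ∀ j, Tendsto (F j) atBot (𝓝 0)) (h1 : ∀ j, Tendsto (F j) atTop (𝓝 1))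
    (C : CorrMatrix p) : ∀ᵐ Y ∂(dataLaw C F), ∀ n : ℕ,
      patternLikelihood (strictPattern fun i : Fin n => Y i) C ≠ 0 := by
  classical
  refine ae_all_iff.2 fun n => ?_
  have h := lintegral_strictPattern_le h0 h1 C (n := n)
    fun w => if patternLikelihood w C = 0 then 1 else 0
  have hz : ∑ w : Fin p → Fin n → Fin n → Prop,
      patternLikelihood w C * (if patternLikelihood w C = 0 then 1 else 0) = 0 :=
    Finset.sum_eq_zero fun w _ => by by_cases hw : patternLikelihood w C = 0 <;> simp [hw]
  have hf := measurable_strictPattern_comp (p := p) (n := n)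
    fun w => if patternLikelihood w C = 0 then 1 else 0
  rw [hz, nonpos_iff_eq_zero, lintegral_eq_zero_iff hf] at h
  filter_upwards [h] with Y hY hc
  simp [hc] at hY

/-- A pattern of zero evidence has zero likelihood at almost every `C`, and there are countably many
patterns. This keeps the default value of the inverse out of the posterior at observed patterns. -/
theorem ae_lintegral_patternLikelihood_ne_zero {p : ℕ} (Pr : Measure (CorrMatrix p)) :
    ∀ᵐ C ∂Pr, ∀ (n : ℕ) (w : Fin p → Fin n → Fin n → Prop), patternLikelihood w C ≠ 0 →
      ∫⁻ C', patternLikelihood w C' ∂Pr ≠ 0 := by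
  refine ae_all_iff.2 fun n => ae_all_iff.2 fun w => ?_
  by_cases h : ∫⁻ C', patternLikelihood w C' ∂Pr = 0
  · filter_upwards [(lintegral_eq_zero_iff (measurable_patternLikelihood w)).1 h] with C hC hne
    exact absurd hC hne
  · exact ae_of_all _ fun _ _ => h

theorem isProbabilityMeasure_patternPosterior {n p : ℕ} {Pr : Measure (CorrMatrix p)}
    [IsProbabilityMeasure Pr] {w : Fin p → Fin n → Fin n → Prop}
    (h : ∫⁻ C, patternLikelihood w C ∂Pr ≠ 0) : IsProbabilityMeasure (patternPosterior Pr w) := by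
  refine ⟨?_⟩
  rw [patternPosterior, Measure.smul_apply, withDensity_apply _ MeasurableSet.univ,
    Measure.restrict_univ, smul_eq_mul, ENNReal.inv_mul_cancel h]
  refine ne_top_of_le_ne_top ENNReal.one_ne_top
    ((lintegral_mono fun C => patternLikelihood_le_one w C).trans ?_)
  simp

theorem abs_orthantProb_sub_le_of_notMem_farSet {n p : ℕ} {t g a : Fin p → ℝ} {κ η : ℝ}
    {Y : Fin n → Fin p → ℝ} (hn : 0 < n) (hY : IsTypical t g κ η Y) {C C₀ : CorrMatrix p}
    (hC₀ : ∀ j l, |(belowCount t Y j l : ℝ) - n * orthantProb a C₀ j l| ≤ η * n)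
    (hC : C ∉ farSet t g a κ η (strictPattern Y)) (j l : Fin p) :
    |orthantProb a C j l - orthantProb a C₀ j l| ≤ 6 * η := by
  have h : |(belowCount t Y j l : ℝ) - n * orthantProb a C j l| ≤ 5 * η * n := by
    by_contra! hc
    exact hC ⟨j, l, _, ⟨Y, hY, rfl, rfl⟩, hc⟩
  have hn' : (0 : ℝ) < n := Nat.cast_pos.2 hn
  have h2 := abs_le.1 h
  have h3 := abs_le.1 (hC₀ j l)
  rw [abs_le]
  constructor <;> refine le_of_mul_le_mul_left ?_ hn' <;> linarith

theorem theorem1 {p : ℕ}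
    -- the prior `Pr`, with density `dens` with respect to `ν`
    (ν Pr : Measure (CorrMatrix p)) [IsProbabilityMeasure Pr]
    (dens : CorrMatrix p → ℝ≥0∞) (hdens : Measurable dens)
    (hPr : Pr = ν.withDensity dens) (hpos : ∀ᵐ C ∂ν, 0 < dens C)
    -- the true marginal cdfs, none of them the cdf of a constant
    (F : Fin p → StieltjesFunction ℝ)
    (hF0 : ∀ j, Tendsto (F j) atBot (𝓝 0)) (hF1 : ∀ j, Tendsto (F j) atTop (𝓝 1))
    (hFnd : ∀ j, ∃ t, 0 < F j t ∧ F j t < 1) :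
    ∀ᵐ C₀ ∂ν, ∀ A ∈ 𝓝 C₀, ∀ᵐ Y ∂(dataLaw C₀ F),
      Tendsto (fun n : ℕ => rankPosterior Pr (fun i : Fin n => Y i) A) atTop (𝓝 1) := by
  have hac : ν ≪ Pr := by
    rw [hPr]
    exact withDensity_absolutelyContinuous' hdens.aemeasurable (hpos.mono fun C hC => hC.ne')
  -- Positivity of the density makes every prior-null set `ν`-null, so it suffices to argue for
  -- prior-almost every `C₀`.
  refine hac.ae_le ?_
  choose t ht using hFnd
  choose a ha using fun j => exists_stdNormalCDF_le_iff (c := F j (t j)) (ht j)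
  set g : Fin p → ℝ := fun j => (gaussianReal 0 1).real (Set.Iic (a j))
  have hg (C : CorrMatrix p) (j : Fin p) : orthantProb a C j j = g j := orthantProb_self a C j
  -- Tolerances run through a countable family so that one null set of `C₀` serves all
  -- neighbourhoods `A`.
  have hη (m : ℕ) : (0 : ℝ) < 1 / (m + 1) := Nat.one_div_pos_of_nat
  choose κ hκ hsum using fun m : ℕ =>
    exists_ae_tsum_patternPosterior_farSet_ne_top Pr (t := t) (hη m) hg
  filter_upwards [ae_all_iff.2 hsum, ae_lintegral_patternLikelihood_ne_zero Pr]
    with C₀ hC₀ hne A hA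
  obtain ⟨ε, hε, hεA⟩ := exists_forall_abs_orthantProb_sub_le_imp_mem a hA
  -- The 6 combines `5η` from the complement of the far set with `η` from the law of large numbers
  -- at `C₀`.
  obtain ⟨m, hm⟩ := exists_nat_one_div_lt (show 0 < ε / 6 by positivity)
  have := isProbabilityMeasure_copulaLaw C₀ F hF0 hF1
  filter_upwards [ae_eventually_abs_belowCount_sub_le hF0 hF1 ha C₀ (hη m),
    ae_all_iff.2 fun j => ae_eventually_card_tiedValues_le (copulaLaw C₀ F) (hκ m) j,
    ae_tendsto_patternPosterior_farSet hF0 hF1 Pr (hC₀ m),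
    ae_patternLikelihood_ne_zero hF0 hF1 C₀] with Y hcount htied hpost hlik
  have hprob (n : ℕ) :
      IsProbabilityMeasure (patternPosterior Pr (strictPattern fun i : Fin n => Y i)) :=
    isProbabilityMeasure_patternPosterior (hne n _ (hlik n))
  have hlim := ENNReal.Tendsto.sub (tendsto_const_nhds (x := (1 : ℝ≥0∞))) hpost
    (Or.inl ENNReal.one_ne_top)
  rw [tsub_zero] at hlim
  refine tendsto_of_tendsto_of_tendsto_of_le_of_le' hlim tendsto_const_nhds ?_
    (Eventually.of_forall fun n => by
      have := hprob n
      rw [rankPosterior_eq_patternPosterior]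
      exact prob_le_one)
  filter_upwards [hcount, eventually_all.2 htied, eventually_gt_atTop 0] with n h1 h2 h3
  have := hprob n
  have htyp : IsTypical t g (κ m) (1 / (m + 1)) fun i : Fin n => Y i :=
    ⟨h2, fun j => by rw [← hg C₀ j]; exact h1 j j⟩
  -- Only the far set needs to be measurable; `A` is bounded below by monotonicity.
  rw [rankPosterior_eq_patternPosterior, ← prob_compl_eq_one_sub (measurableSet_farSet ..)]
  refine measure_mono fun C hC => hεA C fun j l => ?_
  refine (abs_orthantProb_sub_le_of_notMem_farSet h3 htyp h1 hC j l).trans ?_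
  linarith

end Consistency
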